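/- A convex geometry on a set $X$ is a closure operator $\varphi:2^X\to 2^X$ (extensive, monotone, idempotent) such that $\varphi(\emptyset)=\emptyset$ and, for every closed $Y\subseteq X$ and all distinct $x,y\in X\setminus Y$, if $x\in\varphi(Y\cup\{y\})$ then $y\notin\varphi(Y\cup\{x\})$. Two convex geometries are isomorphic if some bijection between their base sets carries one closure operator to the other. A circle in $\mathbb{R}^2$ is allowed to have radius $0$, in which case it is a point; write $\tilde c$ for the set of points of a circle $c$. For a finite set $S$ of circles and $Z\subseteq S$ put $\mathrm{ch}_c(Z)=\{c\in S:\tilde c\subseteq \mathrm{CH}(\bigcup_{d\in Z}\tilde d)\}$, where $\mathrm{CH}$ is the convex hull in $\mathbb{R}^2$. A convex geometry $(X,\varphi)$ is representable by circles in the plane if there is a bijection from $X$ onto a set $S$ of $|X|$ distinct circles in $\mathbb{R}^2$ that carries $\varphi$ to $\mathrm{ch}_c$. Theorem. Let $X$ be a 5-element set. Up to isomorphism there are exactly $672$ convex geometries on $X$, and at least $623$ of these $672$ isomorphism classes consist of geometries that are representable by (five) circles in the plane. -/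

import Mathlib

/-- A convex geometry on the set `X`: a closure operator `φ` on the subsets of `X` with
`φ ∅ = ∅` and the anti-exchange property. -/
structure ConvexGeometry (X : Type*) where
  /-- the closure operator -/
  φ : ClosureOperator (Set X)
  closure_empty : φ ∅ = ∅
  anti_exchange : ∀ Y : Set X, φ Y = Y → ∀ x y : X, x ∉ Y → y ∉ Y → x ≠ y →
    x ∈ φ (Y ∪ {y}) → y ∉ φ (Y ∪ {x})

/-- A circle in the plane. Radius `0` is allowed; such a circle is a point. -/
@[ext]
structure PlaneCircle where
  center : EuclideanSpace ℝ (Fin 2)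
  radius : ℝ
  radius_nonneg : 0 ≤ radius

/-- The set of points belonging to the circle. -/
def PlaneCircle.points (x : PlaneCircle) : Set (EuclideanSpace ℝ (Fin 2)) :=
  Metric.sphere x.center x.radius

/-- The convex hull operator for circles on a set `S` of circles: `circleHull S Y` consists of
the circles in `S` all of whose points lie in the convex hull of the union of the circles
in `Y`. -/
def circleHull (S Y : Set PlaneCircle) : Set PlaneCircle :=
  {x ∈ S | x.points ⊆ convexHull ℝ (⋃ y ∈ Y, y.points)}

namespace ConvexGeometry

/-- Two convex geometries are isomorphic if some bijection of their base sets carries one closure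
operator to the other. -/
def Isomorphic {X Y : Type*} (G : ConvexGeometry X) (H : ConvexGeometry Y) : Prop :=
  ∃ e : X ≃ Y, ∀ A : Set X, e '' G.φ A = H.φ (e '' A)

/-- Isomorphism of convex geometries on `X`, as an equivalence relation. -/
def isoSetoid (X : Type*) : Setoid (ConvexGeometry X) where
  r := Isomorphic
  iseqv := by
    refine ⟨fun G => ⟨Equiv.refl X, fun A => by simp⟩, ?_, ?_⟩
    · rintro G H ⟨e, he⟩
      refine ⟨e.symm, fun A => ?_⟩
      have h := he (e.symm '' A)
      rw [Equiv.image_symm_image] at h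
      rw [← h, Equiv.symm_image_image]
    · rintro G H K ⟨e, he⟩ ⟨f, hf⟩
      refine ⟨e.trans f, fun A => ?_⟩
      rw [Equiv.coe_trans, Set.image_comp, Set.image_comp, he, hf]

/-- The isomorphism classes of convex geometries on `X`. -/
abbrev IsoClass (X : Type*) : Type _ := Quotient (isoSetoid X)

/-- The isomorphism class of a convex geometry. -/
def isoClass {X : Type*} (G : ConvexGeometry X) : IsoClass X :=
  Quotient.mk (isoSetoid X) G

/-- `G` is representable by circles in the plane: the elements of the base set correspond
bijectively to pairwise distinct circles in such a way that the closure operator of `G` becomes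
the convex hull operator for circles on the set of these circles. -/
def RepresentableByCircles {X : Type*} (G : ConvexGeometry X) : Prop :=
  ∃ c : X → PlaneCircle, Function.Injective c ∧
    ∀ Y : Set X, c '' G.φ Y = circleHull (Set.range c) (c '' Y)

end ConvexGeometry

/-! On a finite set a convex geometry is determined by its closed sets. The families that occur
contain the empty set and the whole set, allow a one-point closed extension of every proper closed
set, and contain `A` whenever they contain two distinct sets obtained by adding one point to `A`.
These conditions are local: whether `A` belongs is constrained only by which sets `A ∪ {x}` belong.

Classification. A family on `Fin 5` is a 32-digit binary number. Deciding the digits from the full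
set downwards, each digit is forced or free depending on whether none, one or several covers are
present, so a search bounds the number of labelled families by 59386 (`encard_le_countFamilies`). A
table lists 672 convex families, each the least mask in its orbit under the symmetric group, so
distinct entries are not isomorphic. By orbit-stabilizer their orbits have total size 59386 as well.
Hence the disjoint orbits exhaust all families (`exists_smul_maskFamily_eq`), and no isomorphism
class is missing.

Representability. A circle lies in the convex hull of finitely many others if and only if, in every
unit direction, its support function is at most that of one of them
(`PlaneCircle.points_subset_convexHull_iff`). A claimed circle representation thus needs one
strictly separating direction for each closed set and each outside point, and, for each other set, a
single outside circle dominated in all directions. The second requirement becomes finite through the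
half-angle substitution `u = z² / |z|²`: up to a positive factor the support function is a quadratic
form in `z`, and on a cone spanned by two vectors three coefficient inequalities imply domination
(`NatCircle.exists_support_eq_combination`). Integer circles in the table pass this test for at
least 623 entries. -/

open scoped Pointwise

/-! ### Families of closed sets and their local description -/

/-- The families of closed sets of convex geometries, described by local conditions. -/
structure IsConvexFamily {X : Type*} (C : Set (Set X)) : Prop where
  empty_mem : ∅ ∈ C
  univ_mem : Set.univ ∈ C
  exists_insert_mem : ∀ A ∈ C, A ≠ Set.univ → ∃ x ∉ A, insert x A ∈ C
  mem_of_insert_mem : ∀ (A : Set X) (x y : X), x ≠ y → insert x A ∈ C → insert y A ∈ C → A ∈ C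

namespace IsConvexFamily

variable {X : Type*} {C : Set (Set X)}

/-- Induction on the number of points missing from `A` and `B`. Extend `A` by `x` and `B` by `y`
inside the family. If `x ∉ B` or `y ∉ A`, one extension leaves the intersection unchanged; otherwise
`A ∩ B` with `x` added and with `y` added both belong, and the last local condition applies. -/
theorem inter_mem [Finite X] (h : IsConvexFamily C) {A B : Set X} (hA : A ∈ C) (hB : B ∈ C) :
    A ∩ B ∈ C := by
  induction hn : (Aᶜ).ncard + (Bᶜ).ncard using Nat.strong_induction_on generalizing A B with
  | _ n ih =>
    subst hn
    have key : ∀ (D : Set X) (x : X), x ∉ D → ((insert x D)ᶜ).ncard < (Dᶜ).ncard := fun D x hx =>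
      Set.ncard_lt_ncard ((Set.ssubset_iff_of_subset
        (Set.compl_subset_compl.2 (Set.subset_insert x D))).2 ⟨x, hx, by simp⟩)
    by_cases hA' : A = Set.univ
    · simpa [hA'] using hB
    by_cases hB' : B = Set.univ
    · simpa [hB'] using hA
    obtain ⟨x, hx, hxA⟩ := h.exists_insert_mem A hA hA'
    obtain ⟨y, hy, hyB⟩ := h.exists_insert_mem B hB hB'
    have h1 := ih _ (by have := key A x hx; omega) hxA hB rfl
    have h2 := ih _ (by have := key B y hy; omega) hA hyB rfl
    by_cases hxB : x ∈ B
    · by_cases hyA : y ∈ A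
      · rw [Set.insert_inter_of_mem hxB] at h1
        rw [Set.inter_insert_of_mem hyA] at h2
        exact h.mem_of_insert_mem _ x y (fun e => hx (e ▸ hyA)) h1 h2
      · rwa [Set.inter_insert_of_notMem hyA] at h2
    · rwa [Set.insert_inter_of_notMem hxB] at h1

theorem sInter_mem [Finite X] (h : IsConvexFamily C) (S : Set (Set X)) (hS : ∀ A ∈ S, A ∈ C) :
    ⋂₀ S ∈ C := by
  induction S, S.toFinite using Set.Finite.induction_on with
  | empty => simpa using h.univ_mem
  | insert _ _ ih =>
    rw [Set.sInter_insert]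
    exact h.inter_mem (hS _ (Set.mem_insert _ _))
      (ih fun A hA => hS A (Set.mem_insert_of_mem _ hA))

theorem preimage {Y : Type*} (h : IsConvexFamily C) (e : X ≃ Y) :
    IsConvexFamily {B : Set Y | e ⁻¹' B ∈ C} := by
  have aux : ∀ (z : Y) (B : Set Y), e ⁻¹' (insert z B) = insert (e.symm z) (e ⁻¹' B) :=
    fun z B => by ext w; simp [← Equiv.eq_symm_apply]
  refine ⟨by simpa using h.empty_mem, by simpa using h.univ_mem, fun B hB hne => ?_,
    fun B x y hxy hx hy => ?_⟩
  · obtain ⟨x, hx, hxB⟩ := h.exists_insert_mem _ hB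
      (fun hu => hne (e.surjective.preimage_injective (by simpa using hu)))
    exact ⟨e x, hx, by simpa [aux] using hxB⟩
  · simp only [Set.mem_ofPred_eq, aux] at hx hy
    exact h.mem_of_insert_mem _ _ _ (e.symm.injective.ne hxy) hx hy

end IsConvexFamily

/-! ### Convex geometries in terms of closed sets, and isomorphism -/

namespace ConvexGeometry

variable {X Y Z : Type*}

/-- The closed sets of a convex geometry. -/
def closedSets (G : ConvexGeometry X) : Set (Set X) := {A | G.φ A = A}

theorem φ_mem_closedSets (G : ConvexGeometry X) (A : Set X) : G.φ A ∈ G.closedSets :=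
  G.φ.idempotent A

theorem φ_subset (G : ConvexGeometry X) {A B : Set X} (hB : B ∈ G.closedSets) (h : A ⊆ B) :
    G.φ A ⊆ B :=
  (G.φ.monotone h).trans (le_of_eq hB)

theorem isConvexFamily_closedSets [Finite X] (G : ConvexGeometry X) :
    IsConvexFamily G.closedSets where
  empty_mem := G.closure_empty
  univ_mem := Set.eq_univ_of_univ_subset (G.φ.le_closure _)
  exists_insert_mem A hA hne := by
    have hne' : {x | x ∉ A}.Nonempty := by
      by_contra hcon
      exact hne (Set.eq_univ_of_forall fun x => by
        by_contra hx; exact hcon ⟨x, hx⟩)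
    -- Choose the point with the smallest closure over `A`. A further new point `y` in that closure
    -- would, by anti-exchange, have a strictly smaller closure, as it omits `x`.
    obtain ⟨x, hx, hmin⟩ := Set.exists_min_image {x | x ∉ A}
      (fun x => (G.φ (insert x A)).ncard) (Set.toFinite _) hne'
    refine ⟨x, hx, (G.φ.le_closure _).antisymm' fun y hy => ?_⟩
    by_contra hyA
    rw [Set.mem_insert_iff, not_or] at hyA
    have h1 : x ∉ G.φ (insert y A) := by
      have := G.anti_exchange A hA y x hyA.2 hx hyA.1
      rw [Set.union_singleton, Set.union_singleton] at this
      exact this hy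
    have h2 : G.φ (insert y A) ⊆ G.φ (insert x A) :=
      G.φ_subset (G.φ_mem_closedSets _) (Set.insert_subset hy
        ((Set.subset_insert x A).trans (G.φ.le_closure _)))
    have h3 := Set.ncard_lt_ncard ((Set.ssubset_iff_of_subset h2).2
      ⟨x, G.φ.le_closure _ (Set.mem_insert x A), h1⟩)
    exact absurd (hmin y hyA.2) (not_le.2 h3)
  mem_of_insert_mem A x y hxy hx hy := by
    refine (G.φ.le_closure _).antisymm' fun z hz => ?_
    have hzx := G.φ_subset hx (Set.subset_insert x A) hz
    have hzy := G.φ_subset hy (Set.subset_insert y A) hz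
    rcases hzx with rfl | h
    · exact hzy.resolve_left hxy
    · exact h

theorem _root_.IsConvexFamily.exists_closedSets_eq [Finite X] {C : Set (Set X)}
    (h : IsConvexFamily C) : ∃ G : ConvexGeometry X, G.closedSets = C := by
  let φ : ClosureOperator (Set X) := .ofCompletePred (· ∈ C) fun S hS => h.sInter_mem S hS
  have hφ : ∀ A, φ A = A ↔ A ∈ C := fun A => (φ.isClosed_iff (x := A)).symm
  have hle : ∀ {A B : Set X}, B ∈ C → A ⊆ B → φ A ⊆ B := fun {A B} hB hAB =>
    (φ.monotone hAB).trans (le_of_eq ((hφ B).2 hB))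
  refine ⟨⟨φ, (hφ ∅).2 h.empty_mem, fun A hA x y hx hy hxy hxA hyA => ?_⟩, Set.ext hφ⟩
  rw [Set.union_singleton] at hxA hyA
  -- Take a maximal closed `B ⊇ A` avoiding both points. Its one-point extension must contain `x` or
  -- `y`; whichever it contains, the assumed closure relation puts the other one there too, although
  -- only one point was added.
  obtain ⟨B, ⟨⟨hB, hAB⟩, hxB, hyB⟩, hmax⟩ := Set.exists_max_image
    {B : Set X | (B ∈ C ∧ A ⊆ B) ∧ x ∉ B ∧ y ∉ B} Set.ncard (Set.toFinite _)
    ⟨A, ⟨(hφ A).1 hA, subset_rfl⟩, hx, hy⟩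
  obtain ⟨z, hz, hzB⟩ := h.exists_insert_mem B hB (fun hu => hxB (hu ▸ Set.mem_univ x))
  have sub : A ⊆ insert z B := hAB.trans (Set.subset_insert _ _)
  by_cases hxz : x ∈ insert z B
  · have := hle hzB (Set.insert_subset hxz sub) hyA
    rw [Set.mem_insert_iff] at hxz this
    exact hxy ((hxz.resolve_right hxB).trans (this.resolve_right hyB).symm)
  · by_cases hyz : y ∈ insert z B
    · exact hxz (hle hzB (Set.insert_subset hyz sub) hxA)
    · exact absurd (hmax _ ⟨⟨hzB, sub⟩, hxz, hyz⟩) (by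
        rw [Set.ncard_insert_of_notMem hz]; omega)

theorem isomorphic_iff {G : ConvexGeometry X} {H : ConvexGeometry Y} :
    Isomorphic G H ↔ ∃ e : X ≃ Y, ∀ A, A ∈ G.closedSets ↔ e '' A ∈ H.closedSets := by
  constructor
  · rintro ⟨e, he⟩
    refine ⟨e, fun A => ?_⟩
    simp only [closedSets, Set.mem_ofPred_eq, ← he, e.injective.image_injective.eq_iff]
  · rintro ⟨e, he⟩
    refine ⟨e, fun A => Set.Subset.antisymm ?_ ?_⟩
    · have h1 : e.symm '' (H.φ (e '' A)) ∈ G.closedSets := by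
        rw [he, Equiv.image_symm_image]
        exact H.φ_mem_closedSets _
      have h2 := G.φ_subset h1 (A := A) (by
        rw [← Equiv.image_subset, Equiv.image_symm_image]
        exact H.φ.le_closure _)
      rwa [← e.image_subset, Equiv.image_symm_image] at h2
    · exact H.φ_subset ((he _).1 (G.φ_mem_closedSets A)) (Set.image_mono (G.φ.le_closure A))

theorem Isomorphic.symm {G : ConvexGeometry X} {H : ConvexGeometry Y} (h : Isomorphic G H) :
    Isomorphic H G := by
  obtain ⟨e, he⟩ := isomorphic_iff.1 h
  exact isomorphic_iff.2 ⟨e.symm, fun A => by rw [he, Equiv.image_symm_image]⟩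

theorem Isomorphic.trans {G : ConvexGeometry X} {H : ConvexGeometry Y} {K : ConvexGeometry Z}
    (h : Isomorphic G H) (h' : Isomorphic H K) : Isomorphic G K := by
  obtain ⟨e, he⟩ := isomorphic_iff.1 h
  obtain ⟨f, hf⟩ := isomorphic_iff.1 h'
  exact isomorphic_iff.2 ⟨e.trans f, fun A => by rw [he, hf, Equiv.coe_trans, Set.image_comp]⟩

theorem exists_isomorphic [Finite X] (e : X ≃ Y) (G : ConvexGeometry X) :
    ∃ H : ConvexGeometry Y, Isomorphic G H := by
  have := Finite.of_equiv X e
  obtain ⟨H, hH⟩ := (G.isConvexFamily_closedSets.preimage e).exists_closedSets_eq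
  exact ⟨H, isomorphic_iff.2 ⟨e, fun A => by simp [hH]⟩⟩

theorem isomorphic_iff_exists_smul {G H : ConvexGeometry X} :
    Isomorphic G H ↔ ∃ σ : Equiv.Perm X, σ • G.closedSets = H.closedSets := by
  have aux : ∀ (σ : Equiv.Perm X) (A : Set X), σ '' A = σ • A := fun σ A => rfl
  rw [isomorphic_iff]
  refine exists_congr fun σ => ⟨fun h => ?_, fun h A => ?_⟩
  · ext A
    rw [Set.mem_smul_set_iff_inv_smul_mem, h, aux, smul_inv_smul]
  · rw [← h, aux, Set.smul_mem_smul_set_iff]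

theorem RepresentableByCircles.of_isomorphic {G : ConvexGeometry X} {H : ConvexGeometry Y}
    (hG : G.RepresentableByCircles) (h : Isomorphic G H) : H.RepresentableByCircles := by
  obtain ⟨c, hc, hcφ⟩ := hG
  obtain ⟨e, he⟩ := h
  refine ⟨c ∘ e.symm, hc.comp e.symm.injective, fun A => ?_⟩
  have h1 := he (e.symm '' A)
  rw [Equiv.image_symm_image] at h1
  rw [← h1, Set.image_comp, Equiv.symm_image_image, hcφ, Set.image_comp, Set.range_comp,
    e.symm.range_eq_univ, Set.image_univ]

end ConvexGeometry

/-! ### Families of subsets of `Fin 5` as binary numbers -/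

/-- The subset of `Fin 5` whose elements are the positions of the binary digits `1` of `b`. -/
def bitSet (b : ℕ) : Set (Fin 5) := {i | b.testBit i = true}

/-- The family of subsets of `Fin 5` encoded by `m`: the set `bitSet b` belongs to it when the
binary digit of `m` at position `b` is `1`. -/
def maskFamily (m : ℕ) : Set (Set (Fin 5)) := {A | ∃ b < 32, m.testBit b = true ∧ bitSet b = A}

theorem mem_bitSet {b : ℕ} {i : Fin 5} : i ∈ bitSet b ↔ b.testBit i = true := Iff.rfl

theorem bitSet_injOn {b c : ℕ} (hb : b < 32) (hc : c < 32) (h : bitSet b = bitSet c) : b = c := by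
  refine Nat.eq_of_testBit_eq fun i => ?_
  by_cases hi : i < 5
  · have := Set.ext_iff.1 h ⟨i, hi⟩
    simp only [mem_bitSet] at this
    exact Bool.eq_iff_iff.2 this
  · have h32 : 32 ≤ 2 ^ i := Nat.pow_le_pow_right (n := 2) two_pos (not_lt.1 hi)
    rw [Nat.testBit_lt_two_pow (by omega), Nat.testBit_lt_two_pow (by omega)]

theorem exists_bitSet_eq (A : Set (Fin 5)) : ∃ b < 32, bitSet b = A := by
  classical
  refine ⟨Nat.ofBits fun i : Fin 5 => decide (i ∈ A), Nat.ofBits_lt_two_pow _, ?_⟩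
  ext i
  rw [mem_bitSet, Nat.testBit_ofBits_lt _ _ i.2]
  simp

theorem bitSet_mem_maskFamily {m b : ℕ} (hb : b < 32) :
    bitSet b ∈ maskFamily m ↔ m.testBit b = true := by
  constructor
  · rintro ⟨c, hc, hm, h⟩
    exact bitSet_injOn hc hb h ▸ hm
  · exact fun h => ⟨b, hb, h, rfl⟩

theorem maskFamily_injOn {m n : ℕ} (hm : m < 2 ^ 32) (hn : n < 2 ^ 32)
    (h : maskFamily m = maskFamily n) : m = n := by
  refine Nat.eq_of_testBit_eq fun b => ?_
  by_cases hb : b < 32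
  · rw [Bool.eq_iff_iff, ← bitSet_mem_maskFamily hb, h, bitSet_mem_maskFamily hb]
  · have : 2 ^ 32 ≤ 2 ^ b := Nat.pow_le_pow_right (n := 2) two_pos (not_lt.1 hb)
    rw [Nat.testBit_lt_two_pow (by omega), Nat.testBit_lt_two_pow (by omega)]

theorem exists_maskFamily_eq (C : Set (Set (Fin 5))) : ∃ m < 2 ^ 32, maskFamily m = C := by
  classical
  refine ⟨Nat.ofBits fun b : Fin 32 => decide (bitSet b ∈ C), Nat.ofBits_lt_two_pow _, ?_⟩
  ext A
  obtain ⟨b, hb, rfl⟩ := exists_bitSet_eq A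
  rw [bitSet_mem_maskFamily hb, Nat.testBit_ofBits_lt _ _ hb]
  simp

theorem insert_bitSet (b : ℕ) (i : Fin 5) : insert i (bitSet b) = bitSet (b ||| 2 ^ (i : ℕ)) := by
  ext j
  rw [Set.mem_insert_iff, mem_bitSet, mem_bitSet, Nat.testBit_or, Nat.testBit_two_pow,
    Bool.or_eq_true, decide_eq_true_eq, Fin.ext_iff, or_comm, eq_comm (a := (j : ℕ))]

theorem bitSet_eq_univ {b : ℕ} (hb : b < 32) : bitSet b = Set.univ ↔ b = 31 := by
  have : bitSet 31 = Set.univ := Set.eq_univ_of_forall (by simp only [mem_bitSet]; decide)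
  rw [← this]
  exact ⟨bitSet_injOn hb (by decide), fun h => h ▸ rfl⟩

/-- The indices of the sets covering `bitSet b`, as binary digits shifted by `b + 1`. -/
def coverMask (b : ℕ) : ℕ :=
  ((List.range 5).foldr
    (fun i acc => cond (b.testBit i) acc (acc ||| 2 ^ (b ||| 2 ^ i))) 0) >>> (b + 1)

theorem testBit_coverMask {b j : ℕ} (hb : b < 32) : (coverMask b).testBit j = true ↔
    ∃ i : Fin 5, b.testBit i = false ∧ b + 1 + j = b ||| 2 ^ (i : ℕ) := by
  by_cases hj : j < 32
  · have : ∀ b < 32, ∀ j < 32, (coverMask b).testBit j = true ↔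
      ∃ i : Fin 5, b.testBit i = false ∧ b + 1 + j = b ||| 2 ^ (i : ℕ) := by decide +kernel
    exact this b hb j hj
  · have h1 : ∀ b < 32, coverMask b < 2 ^ 32 := by decide +kernel
    have h2 : ∀ b < 32, ∀ i : Fin 5, b ||| 2 ^ (i : ℕ) < 32 := by decide +kernel
    have : 2 ^ 32 ≤ 2 ^ j := Nat.pow_le_pow_right (n := 2) two_pos (not_lt.1 hj)
    rw [Nat.testBit_lt_two_pow ((h1 b hb).trans_le this)]
    refine ⟨fun h => by simp at h, ?_⟩
    rintro ⟨i, -, hi⟩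
    have := h2 b hb i
    omega

/-- Covers have larger indices than the set itself, so the local condition at `b` involves only the
digits of the mask from `b` upwards. This is why the masks are shifted by `b + 1`, and why a search
from the top digit can apply each condition at once. -/
theorem lt_or_two_pow {b : ℕ} (hb : b < 32) (i : Fin 5) (hi : b.testBit i = false) :
    b < b ||| 2 ^ (i : ℕ) ∧ b ||| 2 ^ (i : ℕ) < 32 := by
  have : ∀ b < 32, ∀ i : Fin 5, b.testBit i = false →
    b < b ||| 2 ^ (i : ℕ) ∧ b ||| 2 ^ (i : ℕ) < 32 := by decide +kernel
  exact this b hb i hi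

theorem testBit_and_coverMask {m b j : ℕ} (hb : b < 32) :
    ((m >>> (b + 1)) &&& coverMask b).testBit j = true ↔
      ∃ i : Fin 5, b.testBit i = false ∧ b + 1 + j = b ||| 2 ^ (i : ℕ) ∧
        insert i (bitSet b) ∈ maskFamily m := by
  rw [Nat.testBit_and, Bool.and_eq_true, testBit_coverMask hb, Nat.testBit_shiftRight]
  constructor
  · rintro ⟨h, i, hi, hj⟩
    refine ⟨i, hi, hj, ?_⟩
    rwa [insert_bitSet, bitSet_mem_maskFamily (lt_or_two_pow hb i hi).2, ← hj]
  · rintro ⟨i, hi, hj, h⟩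
    rw [insert_bitSet, bitSet_mem_maskFamily (lt_or_two_pow hb i hi).2, ← hj] at h
    exact ⟨h, i, hi, hj⟩

theorem and_coverMask_ne_zero {m b : ℕ} (hb : b < 32) :
    (m >>> (b + 1)) &&& coverMask b ≠ 0 ↔
      ∃ i : Fin 5, i ∉ bitSet b ∧ insert i (bitSet b) ∈ maskFamily m := by
  constructor
  · intro h
    obtain ⟨j, hj⟩ := Nat.exists_testBit_of_ne_zero h
    obtain ⟨i, hi, -, him⟩ := (testBit_and_coverMask hb).1 hj
    exact ⟨i, by simp [mem_bitSet, hi], him⟩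
  · rintro ⟨i, hi, him⟩ h0
    rw [mem_bitSet, Bool.not_eq_true] at hi
    have := (testBit_and_coverMask (j := (b ||| 2 ^ (i : ℕ)) - (b + 1)) hb).2
      ⟨i, hi, by have := lt_or_two_pow hb i hi; omega, him⟩
    rw [h0, Nat.zero_testBit] at this
    simp at this

/-- The operation `n &&& (n - 1)` clears the lowest digit `1`, so something remains exactly when
there were two. -/
theorem Nat.and_sub_one_ne_zero_iff {n : ℕ} :
    n &&& (n - 1) ≠ 0 ↔ ∃ i j, i ≠ j ∧ n.testBit i = true ∧ n.testBit j = true := by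
  rcases eq_or_ne n 0 with rfl | hn
  · simp
  rw [Ne, Nat.and_sub_one_eq_zero_iff_isPowerOfTwo hn, ← not_iff_not, not_not]
  constructor
  · rintro ⟨k, rfl⟩ ⟨i, j, hij, hi, hj⟩
    simp only [Nat.testBit_two_pow, decide_eq_true_eq] at hi hj
    exact hij (hi.symm.trans hj)
  · intro h
    obtain ⟨k, hk⟩ := Nat.exists_testBit_of_ne_zero hn
    refine ⟨k, Nat.eq_of_testBit_eq fun j => ?_⟩
    rw [Nat.testBit_two_pow]
    by_cases hkj : k = j
    · simpa [← hkj] using hk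
    · simp only [hkj, decide_false]
      by_contra hj
      exact h ⟨k, j, hkj, hk, by simpa using hj⟩

theorem and_coverMask_and_sub_one_ne_zero {m b q : ℕ} (hb : b < 32)
    (hq : q = (m >>> (b + 1)) &&& coverMask b) :
    q &&& (q - 1) ≠ 0 ↔ ∃ i j : Fin 5, i ≠ j ∧ i ∉ bitSet b ∧ j ∉ bitSet b ∧
      insert i (bitSet b) ∈ maskFamily m ∧ insert j (bitSet b) ∈ maskFamily m := by
  rw [Nat.and_sub_one_ne_zero_iff]
  subst hq
  constructor
  · rintro ⟨k, l, hkl, hk, hl⟩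
    obtain ⟨i, hi, hik, him⟩ := (testBit_and_coverMask hb).1 hk
    obtain ⟨j, hj, hjl, hjm⟩ := (testBit_and_coverMask hb).1 hl
    refine ⟨i, j, ?_, by simp [mem_bitSet, hi], by simp [mem_bitSet, hj], him, hjm⟩
    rintro rfl
    omega
  · rintro ⟨i, j, hij, hi, hj, him, hjm⟩
    have hi' := hi
    rw [mem_bitSet, Bool.not_eq_true] at hi hj
    have h1 := lt_or_two_pow hb i hi
    have h2 := lt_or_two_pow hb j hj
    refine ⟨(b ||| 2 ^ (i : ℕ)) - (b + 1), (b ||| 2 ^ (j : ℕ)) - (b + 1), fun h => ?_,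
      (testBit_and_coverMask hb).2 ⟨i, hi, by omega, him⟩,
      (testBit_and_coverMask hb).2 ⟨j, hj, by omega, hjm⟩⟩
    have h3 : insert i (bitSet b) = insert j (bitSet b) := by
      rw [insert_bitSet, insert_bitSet, show b ||| 2 ^ (i : ℕ) = b ||| 2 ^ (j : ℕ) by omega]
    have h4 : i ∈ insert j (bitSet b) := h3 ▸ Set.mem_insert _ _
    exact h4.elim hij hi'

theorem Nat.beq_zero_eq_false {n : ℕ} (h : n ≠ 0) : Nat.beq n 0 = false := by
  cases n with
  | zero => exact absurd rfl h
  | succ n => rfl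

/-- The local conditions of a convex family at the set `bitSet b`, for the family encoded
by `m`. -/
def locallyConvexAt (m b : ℕ) : Bool :=
  let q := (m >>> (b + 1)) &&& coverMask b
  cond (Nat.beq q 0) (!m.testBit b) (cond (Nat.beq (q &&& (q - 1)) 0) true (m.testBit b))

theorem locallyConvexAt_iff {m b : ℕ} : locallyConvexAt m b = true ↔
    (m.testBit b = true → (m >>> (b + 1)) &&& coverMask b ≠ 0) ∧
      (((m >>> (b + 1)) &&& coverMask b) &&& (((m >>> (b + 1)) &&& coverMask b) - 1) ≠ 0 →
        m.testBit b = true) := by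
  simp only [locallyConvexAt]
  generalize (m >>> (b + 1)) &&& coverMask b = q
  rcases eq_or_ne q 0 with rfl | hq
  · simp
  · have : Nat.beq q 0 = false := Nat.beq_zero_eq_false hq
    rw [this, cond_false]
    by_cases h : q &&& (q - 1) = 0
    · simp [h, hq]
    · have : Nat.beq (q &&& (q - 1)) 0 = false := Nat.beq_zero_eq_false h
      rw [this, cond_false]
      simp [h, hq]

/-- The full set has index 31 and no covers, so it is treated separately and the local conditions
range over `b < 31`. -/
theorem isConvexFamily_maskFamily {m : ℕ} : IsConvexFamily (maskFamily m) ↔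
    m.testBit 0 = true ∧ m.testBit 31 = true ∧ ∀ b < 31, locallyConvexAt m b = true := by
  have h0 : bitSet 0 = ∅ := by ext i; simp [mem_bitSet]
  have h31 := (bitSet_eq_univ (b := 31) (by decide)).2 rfl
  rw [← bitSet_mem_maskFamily (by decide), ← bitSet_mem_maskFamily (by decide), h0, h31]
  constructor
  · intro h
    refine ⟨h.empty_mem, h.univ_mem, fun b hb => locallyConvexAt_iff.2 ⟨fun hm => ?_, fun hm => ?_⟩⟩
    · refine (and_coverMask_ne_zero (by omega)).2 (h.exists_insert_mem _
        ((bitSet_mem_maskFamily (by omega)).2 hm) ?_)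
      rw [Ne, bitSet_eq_univ (by omega)]
      omega
    · obtain ⟨i, j, hij, -, -, hi, hj⟩ :=
        (and_coverMask_and_sub_one_ne_zero (by omega) rfl).1 hm
      exact (bitSet_mem_maskFamily (by omega)).1 (h.mem_of_insert_mem _ i j hij hi hj)
  · rintro ⟨h1, h2, h3⟩
    refine ⟨h1, h2, fun A hA hne => ?_, fun A x y hxy hx hy => ?_⟩
    · obtain ⟨b, hb, rfl⟩ := exists_bitSet_eq A
      rw [Ne, bitSet_eq_univ hb] at hne
      exact (and_coverMask_ne_zero hb).1 ((locallyConvexAt_iff.1 (h3 b (by omega))).1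
        ((bitSet_mem_maskFamily hb).1 hA))
    · by_cases hxA : x ∈ A
      · rwa [Set.insert_eq_of_mem hxA] at hx
      by_cases hyA : y ∈ A
      · rwa [Set.insert_eq_of_mem hyA] at hy
      obtain ⟨b, hb, rfl⟩ := exists_bitSet_eq A
      rcases eq_or_ne b 31 with rfl | hne
      · exact h31 ▸ h2
      · exact (bitSet_mem_maskFamily hb).2 ((locallyConvexAt_iff.1 (h3 b (by omega))).2
          ((and_coverMask_and_sub_one_ne_zero hb rfl).2 ⟨x, y, hxy, hxA, hyA, hx, hy⟩))

/-! ### Bounding the number of labelled families by exhaustive search -/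

/-- The number of convex families on `Fin 5` whose masks have the prefix `p` in front of the last
`n` binary digits, by exhaustive search. -/
def countFamilies : ℕ → ℕ → ℕ
  | 0, p => p % 2
  | n + 1, p =>
    let q := p &&& coverMask n
    cond (Nat.beq q 0) (countFamilies n (2 * p))
      (cond (Nat.beq (q &&& (q - 1)) 0)
        (countFamilies n (2 * p) + countFamilies n (2 * p + 1)) (countFamilies n (2 * p + 1)))

/-- Only the upper bound is needed; the table later supplies equally many families. -/
theorem encard_le_countFamilies (n p : ℕ) :
    {m : ℕ | m >>> n = p ∧ m.testBit 0 = true ∧ ∀ b < n, locallyConvexAt m b = true}.encard ≤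
      countFamilies n p := by
  induction n generalizing p with
  | zero =>
    rcases Nat.mod_two_eq_zero_or_one p with h | h
    · have : {m : ℕ | m >>> 0 = p ∧ m.testBit 0 = true ∧ ∀ b < 0, locallyConvexAt m b = true} =
          ∅ := by
        ext m
        simp only [Nat.shiftRight_zero, Nat.testBit_zero, decide_eq_true_eq, Set.mem_ofPred_eq,
          Set.mem_empty_iff_false, iff_false]
        rintro ⟨rfl, h', -⟩
        omega
      rw [this]; simp
    · refine (Set.encard_le_encard (t := {p}) fun m hm => by simpa using hm.1).trans ?_
      simp [countFamilies, h]
  | succ n ih =>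
    set S : ℕ → Set ℕ := fun p =>
      {m : ℕ | m >>> n = p ∧ m.testBit 0 = true ∧ ∀ b < n, locallyConvexAt m b = true} with hS
    -- With `q` recording the covers present, digit `0` at position `n` excludes two covers, and
    -- digit `1` requires at least one. So the digit is free only when there is exactly one cover.
    have key : ∀ m ∈ {m : ℕ | m >>> (n + 1) = p ∧ m.testBit 0 = true ∧
        ∀ b < n + 1, locallyConvexAt m b = true},
        (m ∈ S (2 * p) ∧ p &&& coverMask n &&& ((p &&& coverMask n) - 1) = 0) ∨
          (m ∈ S (2 * p + 1) ∧ p &&& coverMask n ≠ 0) := by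
      rintro m ⟨h1, h2, h3⟩
      have h4 := h3 n (by omega)
      rw [locallyConvexAt_iff, h1] at h4
      have h5 : m >>> n / 2 = p := by rw [← h1, Nat.shiftRight_succ]
      have h6 : m.testBit n = decide (m >>> n % 2 = 1) := by
        rw [← Nat.testBit_zero, Nat.testBit_shiftRight, Nat.add_zero]
      rw [h6, decide_eq_true_eq] at h4
      rcases Nat.mod_two_eq_zero_or_one (m >>> n) with h | h
      · exact Or.inl ⟨⟨by omega, h2, fun b hb => h3 b (by omega)⟩, by
          by_contra hq; have := h4.2 hq; omega⟩
      · exact Or.inr ⟨⟨by omega, h2, fun b hb => h3 b (by omega)⟩, h4.1 h⟩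
    rw [countFamilies]
    generalize p &&& coverMask n = q at *
    rcases eq_or_ne q 0 with rfl | hq
    · refine le_trans (Set.encard_le_encard fun m hm => ?_) (ih (2 * p))
      exact ((key m hm).resolve_right (by simp)).1
    have : Nat.beq q 0 = false := Nat.beq_zero_eq_false hq
    rw [this, cond_false]
    by_cases h : q &&& (q - 1) = 0
    · rw [h, Nat.beq_refl, cond_true, Nat.cast_add]
      refine le_trans (Set.encard_le_encard (t := S (2 * p) ∪ S (2 * p + 1)) fun m hm => ?_)
        ((Set.encard_union_le _ _).trans (add_le_add (ih _) (ih _)))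
      exact (key m hm).imp And.left And.left
    · have : Nat.beq (q &&& (q - 1)) 0 = false := Nat.beq_zero_eq_false h
      rw [this, cond_false]
      refine le_trans (Set.encard_le_encard fun m hm => ?_) (ih (2 * p + 1))
      exact ((key m hm).resolve_left (fun h' => h h'.2)).1

/-- The prefix `1` is the digit at position 31, which records that the full set is closed. -/
theorem countFamilies_eq : countFamilies 31 1 = 59386 := by decide +kernel

/-! ### Action of the symmetric group on masks -/

/-- The transposition of two neighbouring elements of `Fin 5`. -/
def adjacentSwap : ℕ → Equiv.Perm (Fin 5)
  | 0 => Equiv.swap 0 1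
  | 1 => Equiv.swap 1 2
  | 2 => Equiv.swap 2 3
  | 3 => Equiv.swap 3 4
  | _ => 1

/-- Keeps the binary digits of `m` at the positions `K`, and exchanges those at the positions `A`
with those `s` positions higher. -/
def exchangeBits (K A s m : ℕ) : ℕ :=
  (m &&& K) ||| ((m &&& A) <<< s) ||| ((m >>> s) &&& A)

/-- The action of `adjacentSwap` on masks of families. -/
def swapMask : ℕ → ℕ → ℕ
  -- For the transposition of `i` and `i + 1`, the kept positions are the indices whose digits `i`
  -- and `i + 1` agree. The moved ones have digit `i` equal to `1` and digit `i + 1` equal to `0`;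
  -- exchanging these digits adds `2 ^ i` to the index.
  | 0, m => exchangeBits 0x99999999 0x22222222 1 m
  | 1, m => exchangeBits 0xC3C3C3C3 0x0C0C0C0C 2 m
  | 2, m => exchangeBits 0xF00FF00F 0x00F000F0 4 m
  | 3, m => exchangeBits 0xFF0000FF 0x0000FF00 8 m
  | _, m => m

theorem exchangeBits_lt {K A s m : ℕ} (hK : K < 2 ^ 32) (hA : A <<< s < 2 ^ 32) :
    exchangeBits K A s m < 2 ^ 32 := by
  have hA' : A ≤ A <<< s := by
    rw [Nat.shiftLeft_eq]; exact Nat.le_mul_of_pos_right _ (Nat.two_pow_pos s)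
  refine Nat.or_lt_two_pow (Nat.or_lt_two_pow (Nat.and_le_right.trans_lt hK) ?_)
    (Nat.and_le_right.trans_lt (hA'.trans_lt hA))
  refine lt_of_le_of_lt ?_ hA
  rw [Nat.shiftLeft_eq, Nat.shiftLeft_eq]
  exact Nat.mul_le_mul_right _ Nat.and_le_right

theorem swapMask_lt (i : ℕ) {m : ℕ} (hm : m < 2 ^ 32) : swapMask i m < 2 ^ 32 := by
  unfold swapMask
  split <;> first | exact exchangeBits_lt (by decide) (by decide) | exact hm

/-- The binary digits of `b` at the positions `i` and `i + 1` exchanged. -/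
def swapIndex (i b : ℕ) : ℕ := cond (b.testBit i == b.testBit (i + 1)) b (b ^^^ (3 <<< i))

theorem testBit_exchangeBits {K A s m b : ℕ} : (exchangeBits K A s m).testBit b =
    (m.testBit b && K.testBit b || decide (s ≤ b) && (m.testBit (b - s) && A.testBit (b - s)) ||
      m.testBit (s + b) && A.testBit b) := by
  simp [exchangeBits]

/-- The three cases are a position that is kept, one filled from below, and one filled from above.
Stating them as conditions on digits of constants lets them be decided without reference to `m`. -/
theorem testBit_exchangeBits_eq {K A s b c : ℕ} (m : ℕ)
    (h : (K.testBit b = true ∧ c = b ∧ A.testBit b = false ∧ (s ≤ b → A.testBit (b - s) = false)) ∨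
      (K.testBit b = false ∧ c = b - s ∧ A.testBit b = false ∧ s ≤ b ∧ A.testBit (b - s) = true) ∨
      (K.testBit b = false ∧ c = s + b ∧ A.testBit b = true ∧
        (s ≤ b → A.testBit (b - s) = false))) :
    (exchangeBits K A s m).testBit b = m.testBit c := by
  rw [testBit_exchangeBits]
  rcases h with ⟨h1, rfl, h2, h3⟩ | ⟨h1, rfl, h2, h3, h4⟩ | ⟨h1, rfl, h2, h3⟩
  · by_cases h : s ≤ c <;> simp_all
  · simp_all
  · by_cases h : s ≤ b <;> simp_all

theorem testBit_swapMask {i b : ℕ} (hi : i < 4) (hb : b < 32) (m : ℕ) :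
    (swapMask i m).testBit b = m.testBit (swapIndex i b) := by
  interval_cases i <;> refine testBit_exchangeBits_eq _ ?_ <;> clear hi <;> revert b <;>
    decide +kernel

theorem adjacentSwap_smul_bitSet {i b : ℕ} (hi : i < 4) (hb : b < 32) :
    swapIndex i b < 32 ∧ (adjacentSwap i)⁻¹ • bitSet b = bitSet (swapIndex i b) := by
  have : ∀ i < 4, ∀ b < 32, swapIndex i b < 32 ∧ ∀ j : Fin 5,
      b.testBit (adjacentSwap i j) = (swapIndex i b).testBit j := by decide +kernel
  refine ⟨(this i hi b hb).1, ?_⟩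
  ext j
  rw [Set.mem_inv_smul_set_iff]
  exact Bool.eq_iff_iff.1 ((this i hi b hb).2 j)

theorem maskFamily_swapMask (i m : ℕ) :
    maskFamily (swapMask i m) = adjacentSwap i • maskFamily m := by
  by_cases hi : i < 4
  · ext A
    obtain ⟨b, hb, rfl⟩ := exists_bitSet_eq A
    obtain ⟨h1, h2⟩ := adjacentSwap_smul_bitSet hi hb
    rw [Set.mem_smul_set_iff_inv_smul_mem, h2, bitSet_mem_maskFamily hb,
      bitSet_mem_maskFamily h1, testBit_swapMask hi hb]
  · obtain ⟨j, rfl⟩ := Nat.exists_eq_add_of_le' (not_lt.1 hi)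
    rw [show adjacentSwap (j + 4) = 1 from rfl, one_smul]
    rfl

/-- The results of applying `f (k - 1)`, …, `f 0` to `a` one after the other. -/
def descend {α : Type*} (f : ℕ → α → α) : ℕ → α → List α
  | 0, a => [a]
  | k + 1, a => a :: descend f k (f k a)

/-- The images of `a` under the permutations of `k` elements, when `f i` describes the action of
the transposition of the elements `i` and `i + 1`. -/
def permImages {α : Type*} (f : ℕ → α → α) : ℕ → α → List α
  | 0, a => [a]
  | k + 1, a => (permImages f k a).flatMap (descend f k)

theorem map_descend {α β : Type*} {f : ℕ → α → α} {g : ℕ → β → β} {h : α → β}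
    (hfg : ∀ i a, h (f i a) = g i (h a)) (k : ℕ) (a : α) :
    (descend f k a).map h = descend g k (h a) := by
  induction k generalizing a with
  | zero => rfl
  | succ k ih => rw [descend, descend, List.map_cons, ih, hfg]

/-- The construction commutes with equivariant maps. Applied to masks and to permutations, it shows
that the list of images of a mask runs parallel to the list of all permutations. -/
theorem map_permImages {α β : Type*} {f : ℕ → α → α} {g : ℕ → β → β} {h : α → β}
    (hfg : ∀ i a, h (f i a) = g i (h a)) (k : ℕ) (a : α) :
    (permImages f k a).map h = permImages g k (h a) := by
  induction k with
  | zero => rfl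
  | succ k ih =>
    rw [permImages, permImages, ← ih, List.map_flatMap, List.flatMap_map]
    exact congrArg (fun F => List.flatMap F (permImages f k a))
      (funext fun c => map_descend hfg k c)

theorem forall_mem_descend {α : Type*} {f : ℕ → α → α} {p : α → Prop}
    (hf : ∀ i a, p a → p (f i a)) (k : ℕ) {a : α} (ha : p a) : ∀ c ∈ descend f k a, p c := by
  induction k generalizing a with
  | zero => simpa [descend] using ha
  | succ k ih =>
    rw [descend, List.forall_mem_cons]
    exact ⟨ha, ih (hf k a ha)⟩

theorem forall_mem_permImages {α : Type*} {f : ℕ → α → α} {p : α → Prop}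
    (hf : ∀ i a, p a → p (f i a)) (k : ℕ) {a : α} (ha : p a) : ∀ c ∈ permImages f k a, p c := by
  induction k with
  | zero => simpa [permImages] using ha
  | succ k ih =>
    intro c hc
    rw [permImages, List.mem_flatMap] at hc
    obtain ⟨d, hd, hcd⟩ := hc
    exact forall_mem_descend hf k (ih d hd) c hcd

attribute [local irreducible] permImages

/-- All permutations of `Fin 5`, as products of adjacent transpositions. -/
def allPerms : List (Equiv.Perm (Fin 5)) := permImages (fun i σ => adjacentSwap i * σ) 5 1

theorem nodup_allPerms : allPerms.Nodup := by
  have h : (allPerms.map fun σ => ((List.finRange 5).map fun i => (σ i : ℕ))).Nodup := by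
    decide +kernel
  exact h.of_map

theorem mem_allPerms (σ : Equiv.Perm (Fin 5)) : σ ∈ allPerms := by
  have h1 : allPerms.length = 120 := by decide +kernel
  have h2 : allPerms.toFinset = Finset.univ := by
    rw [← Finset.card_eq_iff_eq_univ, List.toFinset_card_of_nodup nodup_allPerms, h1,
      Fintype.card_perm, Fintype.card_fin]
    rfl
  rw [← List.mem_toFinset, h2]
  exact Finset.mem_univ σ

theorem map_maskFamily_permImages (m : ℕ) :
    (permImages swapMask 5 m).map maskFamily = allPerms.map (· • maskFamily m) := by
  rw [map_permImages (g := fun i C => adjacentSwap i • C) (fun i a => maskFamily_swapMask i a),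
    allPerms, map_permImages (g := fun i C => adjacentSwap i • C) (fun i σ => mul_smul _ _ _),
    one_smul]

/-- `m` is the least mask of a family that arises from that of `m` by a permutation. -/
def isLeastMask (m : ℕ) : Bool := (permImages swapMask 5 m).all (Nat.ble m)

theorem le_of_isLeastMask {m n : ℕ} (h : isLeastMask m = true) (hm : m < 2 ^ 32) (hn : n < 2 ^ 32)
    {σ : Equiv.Perm (Fin 5)} (hσ : σ • maskFamily m = maskFamily n) : m ≤ n := by
  have h1 : σ • maskFamily m ∈ (permImages swapMask 5 m).map maskFamily := by
    rw [map_maskFamily_permImages]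
    exact List.mem_map_of_mem (mem_allPerms σ)
  obtain ⟨c, hc, hcσ⟩ := List.mem_map.1 h1
  have h2 := forall_mem_permImages (p := (· < 2 ^ 32)) (fun i a => swapMask_lt i) 5 hm c hc
  rw [maskFamily_injOn hn h2 (hσ.symm.trans hcσ.symm)]
  exact Nat.le_of_ble_eq_true (List.all_eq_true.1 h c hc)

/-- The number of permutations that fix the family of `m`. -/
def stabilizerCount (m : ℕ) : ℕ := (permImages swapMask 5 m).countP (Nat.beq m)

/-- Orbit-stabilizer. Masks below `2 ^ 32` determine their families, so counting the images equal to
`m` counts the stabilizing permutations. -/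
theorem ncard_orbit_mul_stabilizerCount {m : ℕ} (hm : m < 2 ^ 32) :
    (MulAction.orbit (Equiv.Perm (Fin 5)) (maskFamily m)).ncard * stabilizerCount m = 120 := by
  classical
  have h1 : stabilizerCount m =
      Nat.card (MulAction.stabilizer (Equiv.Perm (Fin 5)) (maskFamily m)) := by
    have h2 : stabilizerCount m = ((permImages swapMask 5 m).map maskFamily).countP
        (fun C => decide (C = maskFamily m)) := by
      rw [List.countP_map]
      refine List.countP_congr fun c hc => ?_
      have h3 := forall_mem_permImages (p := (· < 2 ^ 32)) (fun i a => swapMask_lt i) 5 hm c hc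
      simp only [Function.comp, decide_eq_true_eq]
      exact ⟨fun h => by rw [Nat.eq_of_beq_eq_true h],
        fun h => by rw [maskFamily_injOn hm h3 h.symm]; exact Nat.beq_refl _⟩
    rw [h2, map_maskFamily_permImages, List.countP_map, List.countP_eq_length_filter,
      ← List.toFinset_card_of_nodup (nodup_allPerms.filter _), eq_comm]
    refine Nat.subtype_card _ fun σ => ?_
    simp [mem_allPerms, MulAction.mem_stabilizer_iff]
  rw [h1, ← MulAction.index_stabilizer, mul_comm, Subgroup.card_mul_index, Nat.card_eq_fintype_card,
    Fintype.card_perm, Fintype.card_fin]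
  rfl

/-! ### Hulls of circles and support functions -/

theorem isCompact_convexJoin {E : Type*} [AddCommGroup E] [Module ℝ E] [TopologicalSpace E]
    [IsTopologicalAddGroup E] [ContinuousSMul ℝ E] {s t : Set E} (hs : IsCompact s)
    (ht : IsCompact t) : IsCompact (convexJoin ℝ s t) := by
  have h : convexJoin ℝ s t = (fun p : ℝ × E × E => (1 - p.1) • p.2.1 + p.1 • p.2.2) ''
      (Set.Icc (0 : ℝ) 1 ×ˢ (s ×ˢ t)) := by
    ext x
    simp only [mem_convexJoin, segment_eq_image, Set.mem_image, Set.mem_prod, Prod.exists]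
    constructor
    · rintro ⟨a, ha, b, hb, θ, hθ, rfl⟩
      exact ⟨θ, a, b, ⟨hθ, ha, hb⟩, rfl⟩
    · rintro ⟨θ, a, b, ⟨hθ, ha, hb⟩, rfl⟩
      exact ⟨a, ha, b, hb, θ, hθ, rfl⟩
  rw [h]
  exact (isCompact_Icc.prod (hs.prod ht)).image (by fun_prop)

/-- The sets are added one at a time, since the hull of a union of two nonempty sets is the join of
their hulls. Compactness makes the hull of finitely many circles closed, as strict separation
requires. -/
theorem isCompact_convexHull_biUnion {ι E : Type*} [AddCommGroup E] [Module ℝ E]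
    [TopologicalSpace E] [IsTopologicalAddGroup E] [ContinuousSMul ℝ E] {s : Set ι}
    (hs : s.Finite) {f : ι → Set E} (hf : ∀ i, IsCompact (convexHull ℝ (f i))) :
    IsCompact (convexHull ℝ (⋃ i ∈ s, f i)) := by
  induction s, hs using Set.Finite.induction_on with
  | empty => simp
  | @insert a s _ _ ih =>
    rw [Set.biUnion_insert]
    rcases (f a).eq_empty_or_nonempty with h1 | h1
    · rwa [h1, Set.empty_union]
    rcases (⋃ i ∈ s, f i).eq_empty_or_nonempty with h2 | h2
    · rw [h2, Set.union_empty]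
      exact hf a
    · rw [convexHull_union h1 h2]
      exact isCompact_convexJoin (hf a) ih

namespace PlaneCircle

/-- The support function of the convex hull of a circle. -/
noncomputable def support (c : PlaneCircle) (u : EuclideanSpace ℝ (Fin 2)) : ℝ :=
  inner ℝ u c.center + c.radius

theorem inner_le_support {c : PlaneCircle} {u p : EuclideanSpace ℝ (Fin 2)} (hu : ‖u‖ = 1)
    (hp : p ∈ c.points) : inner ℝ u p ≤ c.support u := by
  have h := real_inner_le_norm u (p - c.center)
  rw [mem_sphere_iff_norm.1 hp, hu, one_mul, inner_sub_right] at h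
  rw [support]
  linarith

theorem exists_inner_eq_support (c : PlaneCircle) {u : EuclideanSpace ℝ (Fin 2)} (hu : ‖u‖ = 1) :
    ∃ p ∈ c.points, inner ℝ u p = c.support u := by
  refine ⟨c.center + c.radius • u, ?_, ?_⟩
  · rw [points, mem_sphere_iff_norm, add_sub_cancel_left, norm_smul, hu, mul_one,
      Real.norm_of_nonneg c.radius_nonneg]
  · rw [inner_add_right, inner_smul_right, real_inner_self_eq_norm_sq, hu, support]
    ring

theorem isCompact_convexHull_points (c : PlaneCircle) : IsCompact (convexHull ℝ c.points) := by
  rw [points, convexHull_sphere_eq_closedBall _ c.radius_nonneg]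
  exact isCompact_closedBall _ _

/-- If all circles of `s` stay strictly below `c` in direction `u`, an open half-plane contains
their hull but misses the extreme point of `c`. Conversely, a point of `c` outside the closed hull
is strictly separated by a functional, whose normalized Riesz vector is a direction contradicting
the assumption. -/
theorem points_subset_convexHull_iff {s : Set PlaneCircle} (hs : s.Finite) (c : PlaneCircle) :
    c.points ⊆ convexHull ℝ (⋃ d ∈ s, d.points) ↔
      ∀ u : EuclideanSpace ℝ (Fin 2), ‖u‖ = 1 → ∃ d ∈ s, c.support u ≤ d.support u := by
  constructor
  · intro h u hu
    by_contra! hlt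
    obtain ⟨p, hp, hpu⟩ := c.exists_inner_eq_support hu
    have hsub : ⋃ d ∈ s, d.points ⊆ {q | inner ℝ u q < c.support u} :=
      Set.iUnion₂_subset fun d hd q hq => (inner_le_support hu hq).trans_lt (hlt d hd)
    have hconv : Convex ℝ {q : EuclideanSpace ℝ (Fin 2) | inner ℝ u q < c.support u} :=
      convex_halfSpace_lt (innerₛₗ ℝ u).isLinear _
    exact absurd (convexHull_min hsub hconv (h hp)) (by simp [hpu])
  · intro h p hp
    by_contra hpK
    obtain ⟨f, t, hft, htp⟩ := geometric_hahn_banach_closed_point (convex_convexHull ℝ _)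
      (isCompact_convexHull_biUnion hs fun d => d.isCompact_convexHull_points).isClosed hpK
    set v := (InnerProductSpace.toDual ℝ (EuclideanSpace ℝ (Fin 2))).symm f with hv
    have hf : ∀ q, f q = inner ℝ v q := fun q => by
      rw [hv, InnerProductSpace.toDual_symm_apply]
    -- Any unit vector will do: the hypothesis at `e` shows that `s` is nonempty, which is needed to
    -- see that the separating functional is nonzero.
    obtain ⟨e, he⟩ : ∃ e : EuclideanSpace ℝ (Fin 2), ‖e‖ = 1 := exists_norm_eq _ zero_le_one
    have hne : ∃ d, d ∈ s := (h e he).imp fun d hd => hd.1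
    have key : ∀ d ∈ s, ∀ q ∈ d.points, f q < f p := fun d hd q hq =>
      (hft q (subset_convexHull ℝ _ (Set.mem_biUnion hd hq))).trans htp
    have hv0 : v ≠ 0 := by
      rintro h0
      obtain ⟨d, hd⟩ := hne
      obtain ⟨q, hq, -⟩ := d.exists_inner_eq_support he
      have := key d hd q hq
      simp [hf, h0] at this
    have hpos : 0 < ‖v‖ := norm_pos_iff.2 hv0
    have hu : ‖(‖v‖⁻¹ • v)‖ = 1 := by
      rw [norm_smul, norm_inv, norm_norm, inv_mul_cancel₀ hpos.ne']
    obtain ⟨d, hd, hcd⟩ := h _ hu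
    obtain ⟨q, hq, hqd⟩ := d.exists_inner_eq_support hu
    have h1 := inner_le_support hu hp
    have h2 := key d hd q hq
    have h3 := (h1.trans hcd).trans_eq hqd.symm
    rw [real_inner_smul_left, real_inner_smul_left, ← hf, ← hf] at h3
    exact absurd (le_of_mul_le_mul_left h3 (inv_pos.2 hpos)) (not_le.2 h2)

end PlaneCircle

theorem subset_circleHull {S T : Set PlaneCircle} (h : T ⊆ S) : T ⊆ circleHull S T :=
  fun _ hc => ⟨h hc, fun _ hp => subset_convexHull ℝ _ (Set.mem_biUnion hc hp)⟩

theorem circleHull_subset_of_subset {S T U : Set PlaneCircle} (h : T ⊆ circleHull S U) :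
    circleHull S T ⊆ circleHull S U := by
  rintro _ ⟨hc, hcT⟩
  refine ⟨hc, hcT.trans (convexHull_min (Set.iUnion₂_subset fun d hd => (h hd).2)
    (convex_convexHull ℝ _))⟩

namespace ConvexGeometry

variable {X : Type*}

/-- A convex geometry is represented by circles as soon as the closed sets are the right ones. -/
theorem representableByCircles_of_closedSets [Finite X] {G : ConvexGeometry X}
    (c : X → PlaneCircle)
    (h1 : ∀ A ∈ G.closedSets, ∀ x ∉ A, ∃ u : EuclideanSpace ℝ (Fin 2), ‖u‖ = 1 ∧
      ∀ y ∈ A, (c y).support u < (c x).support u)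
    (h2 : ∀ A ∉ G.closedSets, ∃ x ∉ A, ∀ u : EuclideanSpace ℝ (Fin 2), ‖u‖ = 1 →
      ∃ y ∈ A, (c x).support u ≤ (c y).support u) : G.RepresentableByCircles := by
  have mem_iff : ∀ (A : Set X) (x : X), c x ∈ circleHull (Set.range c) (c '' A) ↔
      ∀ u : EuclideanSpace ℝ (Fin 2), ‖u‖ = 1 → ∃ y ∈ A, (c x).support u ≤ (c y).support u := by
    intro A x
    have := PlaneCircle.points_subset_convexHull_iff ((Set.toFinite A).image c) (c x)
    simp only [Set.exists_mem_image] at this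
    exact (and_iff_right (Set.mem_range_self x)).trans this
  let H : Set X → Set X := fun A => c ⁻¹' circleHull (Set.range c) (c '' A)
  have hsub : ∀ A, A ⊆ H A := fun A x hx =>
    subset_circleHull (Set.image_subset_range c A) (Set.mem_image_of_mem c hx)
  have hmin : ∀ A B, A ⊆ H B → H A ⊆ H B := fun A B hAB =>
    Set.preimage_mono (circleHull_subset_of_subset (Set.image_subset_iff.2 hAB))
  have hclosed : ∀ A ∈ G.closedSets, H A = A := fun A hA =>
    Set.Subset.antisymm (fun x hx => by
      by_contra hxA
      obtain ⟨u, hu, hlt⟩ := h1 A hA x hxA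
      obtain ⟨y, hy, hle⟩ := (mem_iff A x).1 hx u hu
      exact absurd (hlt y hy) (not_lt.2 hle)) (hsub A)
  -- Both are closure operators. The closed sets of `G` are fixed by `H`, and `H A` must be closed
  -- in `G`, since otherwise a point outside it would lie in its own hull.
  have hH : ∀ A, H A = G.φ A := by
    refine fun A => Set.Subset.antisymm ?_ (G.φ_subset ?_ (hsub A))
    · rw [← hclosed _ (G.φ_mem_closedSets A)]
      exact hmin _ _ ((G.φ.le_closure A).trans (hsub _))
    · by_contra hA
      obtain ⟨x, hx, hxu⟩ := h2 _ hA
      exact hx (hmin _ _ subset_rfl ((mem_iff (H A) x).2 hxu))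
  refine ⟨c, fun x y hxy => ?_, fun A => ?_⟩
  · by_contra hne
    -- Two elements with the same circle would lie in each other's closure, contradicting
    -- anti-exchange over the empty set. So injectivity need not be assumed.
    have hmem : ∀ x y, c x = c y → x ∈ G.φ (∅ ∪ {y}) := fun x y hxy => by
      rw [← hH, Set.empty_union]
      change c x ∈ circleHull (Set.range c) (c '' {y})
      rw [hxy]
      exact hsub {y} rfl
    exact G.anti_exchange ∅ G.closure_empty x y (Set.notMem_empty x) (Set.notMem_empty y) hne
      (hmem x y hxy) (hmem y x hxy.symm)
  · rw [← hH, Set.image_preimage_eq_of_subset]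
    exact fun d (hd : d ∈ circleHull _ _) => hd.1

end ConvexGeometry

/-! ### Comparing packed sequences of numbers -/

/-- The number with the digits `f 0, …, f (n - 1)` in base `2 ^ 16`. -/
def pack (f : ℕ → ℕ) : ℕ → ℕ
  | 0 => 0
  | n + 1 => 2 ^ (16 * n) * f n + pack f n

theorem pack_lt {f : ℕ → ℕ} {n : ℕ} (hf : ∀ j < n, f j < 2 ^ 16) : pack f n < 2 ^ (16 * n) := by
  induction n with
  | zero => simp [pack]
  | succ n ih =>
    have h1 := ih fun j hj => hf j (by omega)
    have h2 := Nat.mul_le_mul_left (2 ^ (16 * n)) (Nat.succ_le_of_lt (hf n (by omega)))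
    rw [pack, mul_add, mul_one, pow_add]
    rw [Nat.mul_succ] at h2
    omega

theorem testBit_pack {f : ℕ → ℕ} {n : ℕ} (hf : ∀ j < n, f j < 2 ^ 16) (i : ℕ) :
    (pack f n).testBit i = true ↔ i / 16 < n ∧ (f (i / 16)).testBit (i % 16) = true := by
  induction n with
  | zero => simp [pack]
  | succ n ih =>
    have hf' : ∀ j < n, f j < 2 ^ 16 := fun j hj => hf j (by omega)
    rw [pack, Nat.testBit_two_pow_mul_add _ (pack_lt hf')]
    split_ifs with h
    · rw [ih hf', and_congr_left_iff]
      intro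
      omega
    · by_cases h' : i / 16 = n
      · rw [h', show i % 16 = i - 16 * n by omega]
        simp
      · have h2 : 2 ^ 16 ≤ 2 ^ (i - 16 * n) := Nat.pow_le_pow_right (by decide) (by omega)
        rw [Nat.testBit_lt_two_pow ((hf n (by omega)).trans_le h2)]
        simp only [Bool.false_eq_true, false_iff, not_and]
        intro
        omega

theorem pack_add (f g : ℕ → ℕ) (n : ℕ) : pack (fun j => f j + g j) n = pack f n + pack g n := by
  induction n with
  | zero => rfl
  | succ n ih => simp only [pack, ih]; ring

theorem pack_mul (a : ℕ) (f : ℕ → ℕ) (n : ℕ) : pack (fun j => a * f j) n = a * pack f n := by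
  induction n with
  | zero => rfl
  | succ n ih => simp only [pack, ih]; ring

theorem pack_congr {f g : ℕ → ℕ} {n : ℕ} (h : ∀ j < n, f j = g j) : pack f n = pack g n := by
  induction n with
  | zero => rfl
  | succ n ih => rw [pack, pack, h n (by omega), ih fun j hj => h j (by omega)]

/-- Comparison of two sequences with entries below `2 ^ 15`, all entries at once. -/
theorem testBit_pack_sub {f g : ℕ → ℕ} {n j : ℕ} (hf : ∀ j < n, f j < 2 ^ 15)
    (hg : ∀ j < n, g j < 2 ^ 15) (hj : j < n) :
    (pack f n + pack (fun _ => 2 ^ 15) n - pack g n).testBit (16 * j + 15) = true ↔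
      g j ≤ f j := by
  -- Adding `2 ^ 15` to every digit prevents borrowing, so the subtraction acts digit by digit and
  -- the top bit of each digit records the comparison.
  have h : pack f n + pack (fun _ => 2 ^ 15) n - pack g n =
      pack (fun j => f j + 2 ^ 15 - g j) n := by
    rw [← pack_add, Nat.sub_eq_iff_eq_add' (by
      rw [← pack_congr fun j hj =>
        Nat.add_sub_cancel' ((hg j hj).le.trans (Nat.le_add_left _ (f j))),
        pack_add]
      exact Nat.le_add_right _ _), ← pack_add]
    refine pack_congr fun j hj => ?_
    have := hg j hj
    omega
  have h1 := hf j hj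
  have h2 := hg j hj
  rw [h, testBit_pack (fun j hj => by have := hf j hj; omega),
    show (16 * j + 15) / 16 = j by omega, show (16 * j + 15) % 16 = 15 by omega,
    Nat.testBit_eq_decide_div_mod_eq, decide_eq_true_eq]
  omega

/-- The digits of `evenMask n` at the even positions below `n` are `2 ^ 15`, the others `0`. -/
def evenMask (n : ℕ) : ℕ := pack (fun j => cond (Nat.beq (j % 2) 0) (2 ^ 15) 0) n

theorem testBit_evenMask {n i : ℕ} :
    (evenMask n).testBit i = true ↔ ∃ k, 2 * k < n ∧ i = 16 * (2 * k) + 15 := by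
  rw [evenMask, testBit_pack (fun j _ => by cases Nat.beq (j % 2) 0 <;> decide)]
  rcases Nat.mod_two_eq_zero_or_one (i / 16) with h | h
  · rw [h, Nat.beq_refl, cond_true, Nat.testBit_two_pow, decide_eq_true_eq]
    constructor
    · rintro ⟨h1, h2⟩
      exact ⟨i / 16 / 2, by omega, by omega⟩
    · rintro ⟨k, h1, rfl⟩
      omega
  · rw [h, show Nat.beq 1 0 = false from rfl, cond_false, Nat.zero_testBit]
    simp only [Bool.false_eq_true, and_false, false_iff, not_exists, not_and]
    intro k h1 h2
    omega

theorem and_evenMask_eq_iff {n v : ℕ} : Nat.beq (v &&& evenMask n) (evenMask n) = true ↔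
    ∀ k, 2 * k < n → v.testBit (16 * (2 * k) + 15) = true := by
  rw [Nat.beq_eq]
  constructor
  · intro h k hk
    have h1 := testBit_evenMask.2 ⟨k, hk, rfl⟩
    rw [← h, Nat.testBit_and, Bool.and_eq_true] at h1
    exact h1.1
  · refine fun h => Nat.eq_of_testBit_eq fun i => ?_
    rw [Nat.testBit_and, Bool.eq_iff_iff, Bool.and_eq_true, and_iff_right_iff_imp,
      testBit_evenMask]
    rintro ⟨k, hk, rfl⟩
    exact h k hk

/-! ### Test directions and the half-angle substitution -/

/-- The first coordinates of points on half of the boundary of a square, in counterclockwise order;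
their squares as complex numbers point in directions all around the circle. -/
def rootX (k : ℕ) : ℤ := min 4 (12 - k)

/-- The second coordinates of the points with first coordinates `rootX k`. -/
def rootY (k : ℕ) : ℤ := min 4 (k - 4)

/-- Products of neighbouring or equal points, as complex numbers; `dirX` and `dirY` are the
coordinates. For even `j` the products are squares, hence directions with rational norm `dirW j`;
for odd `j` they give the intersections of the tangents at neighbouring directions. -/
def dirX (j : ℕ) : ℤ := rootX (j / 2) * rootX ((j + 1) / 2) - rootY (j / 2) * rootY ((j + 1) / 2)

/-- The second coordinates belonging to `dirX`. -/
def dirY (j : ℕ) : ℤ := rootX (j / 2) * rootY ((j + 1) / 2) + rootY (j / 2) * rootX ((j + 1) / 2)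

/-- The weights belonging to `dirX` and `dirY`. -/
def dirW (j : ℕ) : ℤ := rootX (j / 2) * rootX ((j + 1) / 2) + rootY (j / 2) * rootY ((j + 1) / 2)

/-- A circle with natural numbers as coordinates of the center and as radius. -/
structure NatCircle where
  x : ℕ
  y : ℕ
  r : ℕ

namespace NatCircle

/-- A circle with natural coordinates as a circle in the plane. -/
noncomputable def toPlaneCircle (c : NatCircle) : PlaneCircle :=
  ⟨!₂[(c.x : ℝ), (c.y : ℝ)], c.r, Nat.cast_nonneg _⟩

/-- The support function, multiplied by `dirW j`, at the direction with index `j`. -/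
def value (c : NatCircle) (j : ℕ) : ℤ := c.x * dirX j + c.y * dirY j + c.r * dirW j

theorem support_toPlaneCircle (c : NatCircle) (u : EuclideanSpace ℝ (Fin 2)) :
    c.toPlaneCircle.support u = c.x * u 0 + c.y * u 1 + c.r := by
  simp [PlaneCircle.support, toPlaneCircle, PiLp.inner_apply, Fin.sum_univ_two]

/-- Even indices give squares of Gaussian integers, so `(dirX j, dirY j, dirW j)` is a Pythagorean
triple and division by `dirW j` gives a unit vector. -/
theorem exists_support_eq_value {j : ℕ} (hj : j < 33) (hj2 : j % 2 = 0) :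
    ∃ u : EuclideanSpace ℝ (Fin 2), ‖u‖ = 1 ∧
      ∀ c : NatCircle, c.toPlaneCircle.support u = c.value j / dirW j := by
  have h : ∀ j < 33, j % 2 = 0 → 0 < dirW j ∧ dirX j ^ 2 + dirY j ^ 2 = dirW j ^ 2 := by
    decide +kernel
  obtain ⟨h1, h2⟩ := h j hj hj2
  have h1' : (0 : ℝ) < dirW j := by exact_mod_cast h1
  have h2' : (dirX j : ℝ) ^ 2 + (dirY j : ℝ) ^ 2 = (dirW j : ℝ) ^ 2 := by exact_mod_cast h2
  refine ⟨!₂[(dirX j : ℝ) / dirW j, (dirY j : ℝ) / dirW j], ?_, fun c => ?_⟩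
  · rw [EuclideanSpace.norm_eq, Real.sqrt_eq_one, Fin.sum_univ_two, Real.norm_eq_abs,
      Real.norm_eq_abs, sq_abs, sq_abs]
    simp only [Matrix.cons_val_zero, Matrix.cons_val_one]
    rw [div_pow, div_pow, ← add_div, h2', div_self (by positivity)]
  · rw [support_toPlaneCircle]
    simp only [Matrix.cons_val_zero, Matrix.cons_val_one]
    rw [value]
    push_cast
    field_simp

/-- The sign of `(p, q)` is irrelevant because only squares matter, so a half-plane of directions
suffices. The cross product of the `k`-th root with `(p, q)` starts nonnegative and ends
nonpositive, as the last root is the negative of the first; a consecutive pair where it changes sign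
spans the cone. -/
theorem exists_cone (p q : ℝ) : ∃ k < 16, ∃ a b D : ℝ, 0 ≤ a ∧ 0 ≤ b ∧ 0 < D ∧
    ((D * p = a * rootX k + b * rootX (k + 1) ∧ D * q = a * rootY k + b * rootY (k + 1)) ∨
      (D * -p = a * rootX k + b * rootX (k + 1) ∧ D * -q = a * rootY k + b * rootY (k + 1))) := by
  wlog h0 : 0 ≤ rootX 0 * q - rootY 0 * p generalizing p q
  · obtain ⟨k, hk, a, b, D, ha, hb, hD, h⟩ := this (-p) (-q) (by linarith)
    exact ⟨k, hk, a, b, D, ha, hb, hD, by rw [neg_neg, neg_neg] at h; exact h.symm⟩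
  have h16 : (rootX 16 : ℝ) * q - rootY 16 * p ≤ 0 := by
    have h1 : rootX 16 = -rootX 0 := by decide
    have h2 : rootY 16 = -rootY 0 := by decide
    rw [h1, h2]
    push_cast
    linarith
  obtain ⟨k, hk, h1, h2⟩ : ∃ k < 16, 0 ≤ (rootX k : ℝ) * q - rootY k * p ∧
      (rootX (k + 1) : ℝ) * q - rootY (k + 1) * p ≤ 0 := by
    by_contra! hcon
    have h : ∀ k ≤ 15, 0 ≤ (rootX k : ℝ) * q - rootY k * p := by
      intro k
      induction k with
      | zero => exact fun _ => h0
      | succ k ih => exact fun hk => (hcon k (by omega) (ih (by omega))).le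
    exact absurd (hcon 15 (by decide) (h 15 le_rfl)) (not_lt.2 h16)
  have hdet : ∀ k < 16, 0 < rootX k * rootY (k + 1) - rootY k * rootX (k + 1) := by decide
  have hD : (0 : ℝ) < rootX k * rootY (k + 1) - rootY k * rootX (k + 1) := by
    exact_mod_cast hdet k hk
  -- Cramer's rule, with `D` the determinant of the two spanning roots.
  exact ⟨k, hk, -((rootX (k + 1) : ℝ) * q - rootY (k + 1) * p), rootX k * q - rootY k * p, _,
    neg_nonneg.2 h2, h1, hD, Or.inl ⟨by ring, by ring⟩⟩

theorem value_two_mul (c : NatCircle) (k : ℕ) : c.value (2 * k) =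
    c.x * (rootX k * rootX k - rootY k * rootY k) + c.y * (rootX k * rootY k + rootY k * rootX k) +
      c.r * (rootX k * rootX k + rootY k * rootY k) := by
  rw [value, dirX, dirY, dirW, show 2 * k / 2 = k by omega, show (2 * k + 1) / 2 = k by omega]

theorem value_two_mul_add_one (c : NatCircle) (k : ℕ) : c.value (2 * k + 1) =
    c.x * (rootX k * rootX (k + 1) - rootY k * rootY (k + 1)) +
      c.y * (rootX k * rootY (k + 1) + rootY k * rootX (k + 1)) +
      c.r * (rootX k * rootX (k + 1) + rootY k * rootY (k + 1)) := by
  rw [value, dirX, dirY, dirW, show (2 * k + 1) / 2 = k by omega,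
    show (2 * k + 1 + 1) / 2 = k + 1 by omega]

/-- Write `u` as the normalized square of `z = p + iq`. Then `|z|²` times the support function is a
quadratic form in `z`; expanding it for `z` in a cone of consecutive roots gives its values at both
roots and its polar form at the pair, which is the value at the odd index. All coefficients are
nonnegative, so three inequalities between two circles settle the whole arc. -/
theorem exists_support_eq_combination (u : EuclideanSpace ℝ (Fin 2)) (hu : ‖u‖ = 1) :
    ∃ k < 16, ∃ a b κ : ℝ, 0 ≤ a ∧ 0 ≤ b ∧ 0 < κ ∧ ∀ c : NatCircle,
      κ * c.toPlaneCircle.support u = a ^ 2 * c.value (2 * k) + 2 * (a * b) * c.value (2 * k + 1) +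
        b ^ 2 * c.value (2 * k + 2) := by
  have hu' : u 0 ^ 2 + u 1 ^ 2 = 1 := by
    have := EuclideanSpace.norm_sq_eq u
    rw [hu, Fin.sum_univ_two, Real.norm_eq_abs, Real.norm_eq_abs, sq_abs, sq_abs] at this
    linarith
  -- A square root of `u` up to scaling is `1 + u`, in complex notation. It vanishes at `u = -1`,
  -- where `i` is used instead.
  obtain ⟨p, q, μ, hμ, hx, hy, hw⟩ : ∃ p q μ : ℝ, 0 < μ ∧ μ * u 0 = p ^ 2 - q ^ 2 ∧
      μ * u 1 = 2 * (p * q) ∧ μ = p ^ 2 + q ^ 2 := by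
    by_cases h : u 0 = -1
    · have h1 : u 1 = 0 := by rw [h] at hu'; nlinarith
      exact ⟨0, 1, 1, one_pos, by rw [h]; ring, by rw [h1]; ring, by ring⟩
    · have h1 : -1 < u 0 := lt_of_le_of_ne (by nlinarith [sq_nonneg (u 1)]) (Ne.symm h)
      exact ⟨1 + u 0, u 1, 2 * (1 + u 0), by linarith, by nlinarith, by ring, by nlinarith⟩
  obtain ⟨k, hk, a, b, D, ha, hb, hD, h⟩ := exists_cone p q
  have hsq : (D * p) ^ 2 = (a * rootX k + b * rootX (k + 1)) ^ 2 ∧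
      (D * q) ^ 2 = (a * rootY k + b * rootY (k + 1)) ^ 2 ∧ (D * p) * (D * q) =
        (a * rootX k + b * rootX (k + 1)) * (a * rootY k + b * rootY (k + 1)) := by
    rcases h with ⟨h1, h2⟩ | ⟨h1, h2⟩ <;> rw [← h1, ← h2] <;> exact ⟨by ring, by ring, by ring⟩
  obtain ⟨h1, h2, h3⟩ := hsq
  refine ⟨k, hk, a, b, D ^ 2 * μ, ha, hb, by positivity, fun c => ?_⟩
  rw [support_toPlaneCircle, value_two_mul, value_two_mul_add_one,
    show 2 * k + 2 = 2 * (k + 1) by ring, value_two_mul]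
  push_cast
  have e : D ^ 2 * μ * (c.x * u 0 + c.y * u 1 + c.r) =
      c.x * ((D * p) ^ 2 - (D * q) ^ 2) + c.y * (2 * ((D * p) * (D * q))) +
        c.r * ((D * p) ^ 2 + (D * q) ^ 2) := by
    linear_combination D ^ 2 * c.x * hx + D ^ 2 * c.y * hy + D ^ 2 * c.r * hw
  rw [e, h1, h2, h3]
  ring

/-- The sequence of the values at the directions with indices below `33`, up to an offset which
makes the numbers nonnegative. -/
def packedValues (c : NatCircle) : ℕ :=
  c.x * pack (fun j => (dirX j + 64).toNat) 33 + c.y * pack (fun j => (dirY j + 64).toNat) 33 +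
    c.r * pack (fun j => (dirW j).toNat) 33

/-- The digit at position `16 * j + 15` is `1` if and only if the value of `c` at the direction
with index `j` is at least that of `d`. -/
def compareValues (c d : NatCircle) : ℕ :=
  c.packedValues + 64 * (d.x + d.y) * pack (fun _ => 1) 33 + pack (fun _ => 2 ^ 15) 33 -
    (d.packedValues + 64 * (c.x + c.y) * pack (fun _ => 1) 33)

/-- Both packed numbers carry the same offset `64 * (c.x + c.y + d.x + d.y)` in each digit. It
outweighs the negative coordinates, which are at least `-64`, cancels in the comparison, and leaves
all digits below `2 ^ 15`. -/
theorem testBit_compareValues {c d : NatCircle} (hc : c.x < 16 ∧ c.y < 16 ∧ c.r < 16)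
    (hd : d.x < 16 ∧ d.y < 16 ∧ d.r < 16) {j : ℕ} (hj : j < 33) :
    (compareValues c d).testBit (16 * j + 15) = true ↔ d.value j ≤ c.value j := by
  have key : ∀ c d : NatCircle, c.packedValues + 64 * (d.x + d.y) * pack (fun _ => 1) 33 =
      pack (fun j => c.x * (dirX j + 64).toNat + c.y * (dirY j + 64).toNat +
        c.r * (dirW j).toNat + 64 * (d.x + d.y) * 1) 33 := fun c d => by
    rw [packedValues, pack_add (fun j => c.x * (dirX j + 64).toNat + c.y * (dirY j + 64).toNat +
        c.r * (dirW j).toNat), pack_add (fun j => c.x * (dirX j + 64).toNat +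
        c.y * (dirY j + 64).toNat), pack_add, pack_mul, pack_mul, pack_mul, pack_mul]
  have bound : ∀ j < 33, -64 ≤ dirX j ∧ dirX j ≤ 64 ∧ -64 ≤ dirY j ∧ dirY j ≤ 64 ∧ 0 ≤ dirW j ∧
      dirW j ≤ 64 := by decide +kernel
  have small : ∀ c d : NatCircle, (c.x < 16 ∧ c.y < 16 ∧ c.r < 16) →
      (d.x < 16 ∧ d.y < 16 ∧ d.r < 16) → ∀ j < 33,
      c.x * (dirX j + 64).toNat + c.y * (dirY j + 64).toNat + c.r * (dirW j).toNat +
        64 * (d.x + d.y) * 1 < 2 ^ 15 := fun c d hc hd j hj => by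
    have hb := bound j hj
    have h1 := Nat.mul_le_mul (Nat.le_of_lt hc.1) (show (dirX j + 64).toNat ≤ 128 by omega)
    have h2 := Nat.mul_le_mul (Nat.le_of_lt hc.2.1) (show (dirY j + 64).toNat ≤ 128 by omega)
    have h3 := Nat.mul_le_mul (Nat.le_of_lt hc.2.2) (show (dirW j).toNat ≤ 64 by omega)
    omega
  rw [compareValues, key, key, testBit_pack_sub (small c d hc hd) (small d c hd hc) hj, value,
    value]
  obtain ⟨b1, -, b2, -, b3, -⟩ := bound j hj
  zify
  rw [Int.toNat_of_nonneg (by omega), Int.toNat_of_nonneg (by omega), Int.toNat_of_nonneg b3]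
  constructor <;> intro h <;> linarith

end NatCircle

/-! ### Checking a representation by five circles -/

/-- The union of the `J d` for the elements `d` of the set with index `Y`, as binary digits. -/
def orOver (J : ℕ → ℕ) (Y : ℕ) : ℕ :=
  [0, 1, 2, 3, 4].foldr (fun d acc => cond (Y.testBit d) (J d ||| acc) acc) 0

theorem testBit_orOver {J : ℕ → ℕ} {Y i : ℕ} : (orOver J Y).testBit i = true ↔
    ∃ d : Fin 5, d ∈ bitSet Y ∧ (J d).testBit i = true := by
  have h : ∀ l : List ℕ,
      (l.foldr (fun d acc => cond (Y.testBit d) (J d ||| acc) acc) 0).testBit i = true ↔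
        ∃ d ∈ l, Y.testBit d = true ∧ (J d).testBit i = true := by
    intro l
    induction l with
    | nil => simp
    | cons d l ih =>
      rw [List.foldr_cons, List.exists_mem_cons_iff, ← ih]
      cases h : Y.testBit d <;> simp
  rw [orOver, h]
  simp only [List.exists_mem_cons_iff, List.not_mem_nil, false_and, exists_false, or_false,
    Fin.exists_fin_succ, mem_bitSet]
  simp

/-- The `i`-th of the five circles encoded by `t`. -/
def circleOf (t i : ℕ) : NatCircle :=
  ⟨(t >>> (12 * i)) % 16, (t >>> (12 * i + 4)) % 16, (t >>> (12 * i + 8)) % 16⟩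

theorem circleOf_lt (t i : ℕ) :
    (circleOf t i).x < 16 ∧ (circleOf t i).y < 16 ∧ (circleOf t i).r < 16 :=
  ⟨Nat.mod_lt _ (by decide), Nat.mod_lt _ (by decide), Nat.mod_lt _ (by decide)⟩

/-- The comparison of the values of two of the circles encoded by `t`. -/
def compareCircles (t e d : ℕ) : ℕ := (circleOf t d).compareValues (circleOf t e)

/-- The comparison of the values of two of the circles encoded by `t`, at three consecutive
directions. -/
def compareOnArcs (t e d : ℕ) : ℕ :=
  compareCircles t e d &&& compareCircles t e d >>> 16 &&& compareCircles t e d >>> 32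

/-- A sufficient condition for the closed sets of the circles encoded by `t` being those encoded
by `m`. -/
def representsMask (t m : ℕ) : Bool :=
  (List.range 31).all fun Y => cond (m.testBit Y)
    ([0, 1, 2, 3, 4].all fun e =>
      Y.testBit e || !Nat.beq (orOver (compareCircles t e) Y &&& evenMask 33) (evenMask 33))
    ([0, 1, 2, 3, 4].any fun e =>
      !Y.testBit e && Nat.beq (orOver (compareOnArcs t e) Y &&& evenMask 32) (evenMask 32))

theorem testBit_compareCircles {t j : ℕ} (e d : ℕ) (hj : j < 33) :
    (compareCircles t e d).testBit (16 * j + 15) = true ↔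
      (circleOf t e).value j ≤ (circleOf t d).value j :=
  NatCircle.testBit_compareValues (circleOf_lt t d) (circleOf_lt t e) hj

theorem testBit_compareOnArcs {t k : ℕ} (e d : ℕ) (hk : 2 * k < 31) :
    (compareOnArcs t e d).testBit (16 * (2 * k) + 15) = true ↔
      (circleOf t e).value (2 * k) ≤ (circleOf t d).value (2 * k) ∧
        (circleOf t e).value (2 * k + 1) ≤ (circleOf t d).value (2 * k + 1) ∧
          (circleOf t e).value (2 * k + 2) ≤ (circleOf t d).value (2 * k + 2) := by
  rw [compareOnArcs, Nat.testBit_and, Nat.testBit_and, Nat.testBit_shiftRight,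
    Nat.testBit_shiftRight, show 16 + (16 * (2 * k) + 15) = 16 * (2 * k + 1) + 15 by ring,
    show 32 + (16 * (2 * k) + 15) = 16 * (2 * k + 2) + 15 by ring, Bool.and_eq_true,
    Bool.and_eq_true, testBit_compareCircles _ _ (by omega), testBit_compareCircles _ _ (by omega),
    testBit_compareCircles _ _ (by omega), and_assoc]

/-- For a closed set, a missing bit among the 17 even positions gives a direction in which the
outside circle strictly exceeds every circle of the set. For a set that is not closed, a bit at each
of the 16 arcs gives a circle of the set dominating one fixed outside circle along that arc. The
test is only sufficient: separation is sought only in the sample directions, and each arc must be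
covered by a single circle. -/
theorem representableByCircles_of_representsMask {G : ConvexGeometry (Fin 5)} {t m : ℕ}
    (hG : G.closedSets = maskFamily m) (h : representsMask t m = true) :
    G.RepresentableByCircles := by
  have huniv : Set.univ ∈ G.closedSets := G.isConvexFamily_closedSets.univ_mem
  rw [representsMask, List.all_eq_true] at h
  refine ConvexGeometry.representableByCircles_of_closedSets
    (fun i : Fin 5 => (circleOf t i).toPlaneCircle) (fun A hA x hx => ?_) (fun A hA => ?_)
  · obtain ⟨b, hb, rfl⟩ := exists_bitSet_eq A
    have hb31 : b ≠ 31 := by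
      rintro rfl
      exact hx ((bitSet_eq_univ hb).2 rfl ▸ Set.mem_univ x)
    have h1 := h b (List.mem_range.2 (by omega))
    rw [hG, bitSet_mem_maskFamily hb] at hA
    rw [hA, cond_true, List.all_eq_true] at h1
    have h2 := h1 x (by fin_cases x <;> simp)
    rw [mem_bitSet, Bool.not_eq_true] at hx
    rw [hx, Bool.false_or, Bool.not_eq_true', ← Bool.not_eq_true, and_evenMask_eq_iff] at h2
    push Not at h2
    obtain ⟨k, hk, h3⟩ := h2
    rw [Ne, testBit_orOver, not_exists] at h3
    obtain ⟨u, hu, hval⟩ := NatCircle.exists_support_eq_value (j := 2 * k) hk (by omega)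
    have hW : ∀ j < 33, j % 2 = 0 → 0 < dirW j := by decide +kernel
    have hW' : (0 : ℝ) < dirW (2 * k) := by exact_mod_cast hW (2 * k) hk (by omega)
    refine ⟨u, hu, fun y hy => ?_⟩
    have h4 := fun h5 => h3 y ⟨hy, h5⟩
    rw [testBit_compareCircles _ _ hk] at h4
    replace h4 := not_le.1 h4
    rw [hval, hval]
    have h6 : ((circleOf t y).value (2 * k) : ℝ) < (circleOf t x).value (2 * k) := by
      exact_mod_cast h4
    gcongr
  · obtain ⟨b, hb, rfl⟩ := exists_bitSet_eq A
    have hb31 : b ≠ 31 := by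
      rintro rfl
      exact hA ((bitSet_eq_univ hb).2 rfl ▸ huniv)
    have h1 := h b (List.mem_range.2 (by omega))
    rw [hG, bitSet_mem_maskFamily hb, Bool.not_eq_true] at hA
    rw [hA, cond_false, List.any_eq_true] at h1
    obtain ⟨e, he, h2⟩ := h1
    have he5 : e < 5 := by simp at he; omega
    rw [Bool.and_eq_true, Bool.not_eq_true', and_evenMask_eq_iff] at h2
    refine ⟨⟨e, he5⟩, by simp [mem_bitSet, h2.1], fun u hu => ?_⟩
    obtain ⟨k, hk, a, b, κ, ha, hb, hκ, hval⟩ := NatCircle.exists_support_eq_combination u hu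
    obtain ⟨d, hd, h3⟩ := testBit_orOver.1 (h2.2 k (by omega))
    obtain ⟨h4, h5, h6⟩ := (testBit_compareOnArcs e d (by omega)).1 h3
    refine ⟨d, hd, le_of_mul_le_mul_left ?_ hκ⟩
    rw [hval, hval]
    have h4' : ((circleOf t e).value (2 * k) : ℝ) ≤ (circleOf t d).value (2 * k) := by
      exact_mod_cast h4
    have h5' : ((circleOf t e).value (2 * k + 1) : ℝ) ≤ (circleOf t d).value (2 * k + 1) := by
      exact_mod_cast h5
    have h6' : ((circleOf t e).value (2 * k + 2) : ℝ) ≤ (circleOf t d).value (2 * k + 2) := by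
      exact_mod_cast h6
    simp only
    gcongr

/-! ### The table of isomorphism classes and its verification -/

/-- The isomorphism classes of convex geometries on five elements. The first entry is the least mask
of a family of closed sets. The digits of the second are the coordinates and radii of five circles
which represent the geometry; it is `0` where such circles are not known. -/
def table : List (ℕ × ℕ) := [
  (0x8000808B, 0xD03912620520011), (0x8000808F, 0xD53850661451001), (0x800080AB, 0xF32A21720700001),
  (0x800080AF, 0xD10911603236013), (0x800080BF, 0xC01743213250031), (0x800080FF, 0xC75432030002034),
  (0x8000888B, 0xE40A30702602022), (0x8000888F, 0xC00453454243050), (0x800088AB, 0xD33940861730001),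
  (0x800088AF, 0xC03813634260023), (0x800088BB, 0xB60961402471041), (0x800088BF, 0xF52A60609251043),
  (0x800088FF, 0xE27520440232002), (0x80008AAB, 0xB41640603422001), (0x80008AAF, 0xC42505580154043),
  (0x80008ABB, 0xE67704470341032), (0x80008ABF, 0xF79114300023013), (0x80008ACF, 0xD00349135036037),
  (0x80008ADF, 0xF00379165056057), (0x80008AFF, 0xF70309146026027), (0x80008BBB, 0xE013A2160171071),
  (0x80008BBF, 0xC44400457115024), (0x80008BDF, 0xE78490504052161), (0x80008BFF, 0xE226075A0174053),
  (0x80008FFF, 0xE404A7402046063), (0x8000AAAB, 0xB20625601641014), (0x8000AAAF, 0xE03512560267054),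
  (0x8000AABF, 0xC52565330307034), (0x8000AAFF, 0xC53703464450003), (0x8000ABBF, 0xD23475400216033),
  (0x8000ABFF, 0xC563054A8490044), (0x8000AFFF, 0xB71387300116053), (0x8000BFFF, 0xC72005020054023),
  (0x8000FFFF, 0xF08005040072076), (0x8080808B, 0xD63E33745322000), (0x8080808F, 0xC07B44746020245),
  (0x808080AB, 0xC33D08703724050), (0x808080AF, 0x953E00312360031), (0x808080BF, 0xA43F3A238400015),
  (0x808080FF, 0x510B66032100014), (0x8080888B, 0xC21A03710431030), (0x8080888F, 0xFC0801551033035),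
  (0x808088AB, 0xC21A03710441041), (0x808088AF, 0xB38300103012002), (0x808088BB, 0xC00897228247057),
  (0x808088BF, 0xC049A4240065053), (0x808088FF, 0xD25E2021F02C00B), (0x80808A8B, 0xD10863900300021),
  (0x80808A8F, 0xC25800826326013), (0x80808AAB, 0xC21A57710522000), (0x80808AAF, 0xE708056B2160062),
  (0x80808ABB, 0xE46700481350040), (0x80808ABF, 0xC8090F386147058), (0x80808ACF, 0xC07370131041052),
  (0x80808ADF, 0x76080C164055056), (0x80808AFF, 0xF00BE3249158056), (0x80808B8B, 0xB15560805215024),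
  (0x80808B8F, 0xC004B6453163074), (0x80808BAB, 0xC004D3462292092), (0x80808BAF, 0xD436C4700155063),
  (0x80808BBB, 0xB425B0601163062), (0x80808BBF, 0xC5760067A117026), (0x80808BCF, 0xEBB500678055133),
  (0x80808BDF, 0xD505A7406137056), (0x80808BFF, 0x9B6500171060051), (0x80808F8F, 0xEC8200564023041),
  (0x80808FAF, 0xB73405580131053), (0x80808FBF, 0xC30596400145033), (0x80808FFF, 0xD239BF600065037),
  (0x8080AAAB, 0xC01682440444041), (0x8080AAAF, 0xE2075B555407067), (0x8080AABF, 0xC056C1260286083),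
  (0x8080AAFF, 0xE5C8902BB208074), (0x8080ABAB, 0xC77400435452044), (0x8080ABAF, 0xDA0302131142031),
  (0x8080ABBF, 0xD007DA393435076), (0x8080ABFF, 0xEC55016CA6F0053), (0x8080AFAF, 0xB16530637501037),
  (0x8080AFBF, 0xE4559D48050A064), (0x8080AFFF, 0xDA7201154140033), (0x8080BFBF, 0xD032E4280178084),
  (0x8080BFFF, 0xD003C8148051176), (0x8080FFFF, 0xA003C7036032070), (0x8088888B, 0xD0CC40726536048),
  (0x8088888F, 0xE05E80B4305309B), (0x808888AB, 0xC00C87752544041), (0x808888AF, 0xA60A0E406148006),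
  (0x808888BB, 0xC01CC8490373064), (0x808888BF, 0xE00EFA43A165067), (0x808888FF, 0x92075D109018029),
  (0x80888A8B, 0xFB1A07845554050), (0x80888A8F, 0x62080C145045035), (0x80888AAB, 0xD0C6B02A6195095),
  (0x80888AAF, 0x62B850106017016), (0x80888ABB, 0xBAA600271162052), (0x80888ABF, 0x690A0C132053043),
  (0x80888ACF, 0x86D700319037036), (0x80888ADF, 0xB0077E10B01A02A), (0x80888AFF, 0x9037E0195084093),
  (0x80888B8B, 0xC8040B437238038), (0x80888B8F, 0xB2E400244034024), (0x80888BAB, 0xAEA900378175076),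
  (0x80888BAF, 0x6B4600281172061), (0x80888BBB, 0xBC9600280171061), (0x80888BBF, 0x909BF0131043042),
  (0x80888BCF, 0x6C1603280071061), (0x80888BDF, 0x82C600166055045), (0x80888BFF, 0x90BCF019D08B09B),
  (0x80888F8F, 0xB005C8258068067), (0x80888FAF, 0x8C6602180071070), (0x80888FBF, 0xBA0419103024014),
  (0x80888FFF, 0xB004C3187096084), (0x8088A0AB, 0xD10C51961700042), (0x8088A0AF, 0x8B6600240061051),
  (0x8088A0BF, 0xCC0606226263044), (0x8088A0FF, 0x8CCD0015828B097), (0x8088A2AB, 0xE005C73A6385085),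
  (0x8088A2AF, 0x83053B117106017), (0x8088A2BB, 0xB40B3C566654002), (0x8088A2BF, 0x7D1804160290071),
  (0x8088A2FF, 0xA058E0197188095), (0x8088A3AB, 0xB78400311323033), (0x8088A3AF, 0x7007D4162243062),
  (0x8088A3BB, 0xB0E8B01A946B088), (0x8088A3BF, 0x80075D127244036), (0x8088A3FF, 0x96E700165379046),
  (0x8088AAAB, 0xA0B650345215025), (0x8088AAAF, 0xA2D920506348034), (0x8088AABB, 0xA0073E257217028),
  (0x8088AABF, 0xA0065C365305037), (0x8088AAFF, 0xC009B73A0160075), (0x8088ABAB, 0xB044A0382251061),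
  (0x8088ABAF, 0xF0D6C04742AA096), (0x8088ABBB, 0xA046D1360355073), (0x8088ABBF, 0xD007CE396326068),
  (0x8088ABFF, 0xAD0509297284066), (0x8088AFAF, 0xAC0405354150064), (0x8088AFBF, 0xA4020B13A018029),
  (0x8088AFFF, 0x97090E297053178), (0x8088B0BB, 0x6B0604051270061), (0x8088B0BF, 0xC005E42C4272093),
  (0x8088B0FF, 0x600A7E045232025), (0x8088B1BB, 0x9054B0181443062), (0x8088B1BF, 0xC0056E25B237049),
  (0x8088B1FF, 0x7E08070722B0080), (0x8088B3BB, 0x90B680176348046), (0x8088B3BF, 0x9C44001424A2061),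
  (0x8088B3FF, 0x80C9D0034116056), (0x8088BBBB, 0xC1075E409544065), (0x8088BBBF, 0xFC55004133A1062),
  (0x8088BBFF, 0xBE0607277290063), (0x8088BFBF, 0xBE3303250177063), (0x8088BFFF, 0x7B2400154080152),
  (0x8088F0FF, 0x8045C3094047040), (0x8088F1FF, 0xC016ED0A8258080), (0x8088F3FF, 0xD008EE2A6392027),
  (0x8088F7FF, 0xA2D300224009145), (0x8088FFFF, 0x7B3401154160073), (0x808A8A8B, 0x88090E344146036),
  (0x808A8A8F, 0xB0CDE0876355089), (0x808A8AAB, 0xB00B9B52843704A), (0x808A8AAF, 0xB00BA863654500A),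
  (0x808A8ABB, 0xD00DBE51B439067), (0x808A8ABF, 0x80098E308146037), (0x808A8ACF, 0xB0C9C02AA1A9098),
  (0x808A8ADF, 0xAD090A231142053), (0x808A8AFF, 0xA30A6E408328057), (0x808A8B8B, 0xDC0909765555083),
  (0x808A8B8F, 0x80C510245045035), (0x808A8BAB, 0x79080B233144044), (0x808A8BAF, 0x95086E207118027),
  (0x808A8BBB, 0x700BAE207126026), (0x808A8BBF, 0xD009FE33C17A06B), (0x808A8BCF, 0x605AF4260051052),
  (0x808A8BDF, 0x5C0801175084083), (0x808A8BFF, 0x900ACD446265073), (0x808A8C8F, 0x70098C163064053),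
  (0x808A8CAF, 0x63C850107016017), (0x808A8CBF, 0x6046B0175063064), (0x808A8CFF, 0x7E0901195084093),
  (0x808A8D8F, 0xC005D95751A6085), (0x808A8DAF, 0x5026B0243051052), (0x808A8DBF, 0xAEEA002C40950A5),
  (0x808A8DCF, 0x50DCA026C05B04B), (0x808A8DDF, 0xAC090C1AC09A099), (0x808A8DFF, 0x6037C6160062051),
  (0x808A8F8F, 0xA8060E548128058), (0x808A8FAF, 0xAFCB004B52960C3), (0x808A8FBF, 0x98070F316059048),
  (0x808A8FCF, 0x8006B6137047046), (0x808A8FDF, 0xB0047E188079069), (0x808A8FFF, 0x8046D5170081073),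
  (0x808AA2AB, 0x600A9C375163053), (0x808AA2AF, 0x8005B2174164073), (0x808AA2BF, 0x7C1806140270051),
  (0x808AA2FF, 0xCB9A00551472015), (0x808AA3AB, 0x66070B114222024), (0x808AA3AF, 0x98070C104103014),
  (0x808AA3BB, 0xA098F01A7468096), (0x808AA3BF, 0x9B070B124352045), (0x808AA3FF, 0x8C2606141150052),
  (0x808AAAAB, 0x90E890343146046), (0x808AAAAF, 0x7017B1362250063), (0x808AAABB, 0x60B760266126036),
  (0x808AAABF, 0x7067C0284152063), (0x808AAAFF, 0x7068C2140141052), (0x808AABAB, 0x8D0604254163063),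
  (0x808AABAF, 0x9009DD369175066), (0x808AABBB, 0x7D0704251173072), (0x808AABBF, 0x8E0706252184073),
  (0x808AABFF, 0x87C600207118026), (0x808AAFAF, 0x7017D0275162064), (0x808AAFBF, 0xCE0402246242054),
  (0x808AAFFF, 0xBC9300124016033), (0x808AB0BB, 0x60EB80325107008), (0x808AB0BF, 0x9E0808268197086),
  (0x808AB0FF, 0x5C2800253174083), (0x808AB1BB, 0x6039E3381150050), (0x808AB1BF, 0x3007B3151121030),
  (0x808AB1FF, 0x40EA7013922C00A), (0x808AB3BB, 0x9D080A133371053), (0x808AB3BF, 0x9D0A0D37B1A9098),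
  (0x808AB3FF, 0x6E7900077198095), (0x808ABBBB, 0xBF9800380384076), (0x808ABBBF, 0x7036F1390164073),
  (0x808ABBFF, 0x6C3600046064063), (0x808ABFBF, 0x84030C239007027), (0x808ABFFF, 0),
  (0x808AC5CF, 0xB006BC14A05A337), (0x808AC5DF, 0x76C600154045267), (0x808AC5FF, 0x6C3602060061181),
  (0x808ACCCF, 0xB88E10974000679), (0x808ACCDF, 0x6026B4170061051), (0x808ACCFF, 0x7066C2160062052),
  (0x808ACDCF, 0xA0D350123033003), (0x808ACDDF, 0x9008DC2A4085164), (0x808ACDFF, 0x7055C1160072062),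
  (0x808ACFCF, 0x9002B4192092083), (0x808ACFDF, 0x99E800193084066), (0x808ACFFF, 0x7037C5250161033),
  (0x808AD0DF, 0x81031C11A009117), (0x808AD0FF, 0xBCF700151056096), (0x808AD1DF, 0x3027B0151031122),
  (0x808AD1FF, 0x6C0707063061290), (0x808AD5DF, 0xA0B4B0291084165), (0x808AD5FF, 0x30072B114023102),
  (0x808ADDDF, 0x8007AE387047136), (0x808ADDFF, 0x6056C5070063052), (0x808ADFDF, 0xAB0208149037036),
  (0x808ADFFF, 0xD0D260162152043), (0x808AF0FF, 0xABD700133164037), (0x808AF1FF, 0x7002B1081162050),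
  (0x808AF3FF, 0xA008EB294282036), (0x808AF5FF, 0x90058D279039165), (0x808AF7FF, 0xB005AE38B097059),
  (0x808AFFFF, 0x6C0602066074073), (0x808B8B8B, 0x8004D0273183082), (0x808B8B8F, 0x6057C0275175064),
  (0x808B8BAB, 0x7008E6344163064), (0x808B8BAF, 0x590C0E232153042), (0x808B8BBB, 0x50EDB027D15C05C),
  (0x808B8BBF, 0x90089F30A148039), (0x808B8BCF, 0x6C3605160061062), (0x808B8BDF, 0x68FA00287178069),
  (0x808B8BFF, 0x80E650268147036), (0x808B8D8F, 0x7008CB227047037), (0x808B8DAF, 0x7E0C0D261073072),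
  (0x808B8DBF, 0xBE6400125033034), (0x808B8DFF, 0xB0F8B0112033034), (0x808B8F8F, 0x7007E7494192064),
  (0x808B8FAF, 0xAD9500235144037), (0x808B8FBF, 0xC0D9F2240163052), (0x808B8FCF, 0x90A9F02BA0A9098),
  (0x808B8FDF, 0x8097D1140051052), (0x808B8FFF, 0x76C540106015026), (0x808BA3AB, 0xBB070F33B358049),
  (0x808BA3AF, 0xC0E7D03C51B80A7), (0x808BA3BF, 0x8045D2190170081), (0x808BA3FF, 0x9E0500143164052),
  (0x808BAAAB, 0x80C8B0352155055), (0x808BAAAF, 0x70064C266155046), (0x808BAABB, 0x74E700244127026),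
  (0x808BAABF, 0x9DB900229157048), (0x808BAAFF, 0x5007B4136135044), (0x808BABAB, 0x6B0501242151052),
  (0x808BABAF, 0x7056C0270172061), (0x808BABBB, 0x8007E72A1182082), (0x808BABBF, 0x8047F4290171082),
  (0x808BABFF, 0xA076F4190181092), (0x808BAFAF, 0x7E5700441264081), (0x808BAFBF, 0xD0E5F03920C60A5),
  (0x808BAFFF, 0xA064F42B20A00A4), (0x808BB1BB, 0x47D90014725A04A), (0x808BB1BF, 0x5F29004512B30A1),
  (0x808BB1FF, 0x3E0B051A31C20B1), (0x808BB3BB, 0x7C0402144154053), (0x808BB3BF, 0x80C9C0362134045),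
  (0x808BB3FF, 0x5E48031801A1092), (0x808BBBBB, 0x71F630306139038), (0x808BBBBF, 0x8CC800263157066),
  (0x808BBBFF, 0x89E720108129038), (0x808BBFBF, 0x9004E32B1093092), (0x808BBFFF, 0),
  (0x808BCCCF, 0x83030C21A009117), (0x808BCCDF, 0x7D0701165063172), (0x808BCCFF, 0xACE820109028039),
  (0x808BCDCF, 0x80F760215026128), (0x808BCDDF, 0x6D2603250062073), (0x808BCDFF, 0x7D8700246064176),
  (0x808BCFCF, 0xAD4200123022031), (0x808BCFDF, 0x6015B5180071062), (0x808BCFFF, 0x7A070C279168066),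
  (0x808BD1DF, 0x9045F02C10A2182), (0x808BD1FF, 0x9041C00B10A1092), (0x808BD5DF, 0x86C400212033135),
  (0x808BD5FF, 0x90B370151063144), (0x808BDDDF, 0x6076C0261065156), (0x808BDDFF, 0xEDF300141033154),
  (0x808BDFDF, 0x7C0404145054053), (0x808BDFFF, 0xAE0406059058067), (0x808BF0FF, 0x6E7800330175093),
  (0x808BF1FF, 0xA7E200012014034), (0x808BF3FF, 0x51C620313205037), (0x808BF5FF, 0x9D6100020032051),
  (0x808BF7FF, 0x8008DC5A8395047), (0x808BFFFF, 0x6016E4290172063), (0x808F8F8F, 0x6057B0355154066),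
  (0x808F8FAF, 0x7077B0286175087), (0x808F8FBF, 0x80FAC039B058069), (0x808F8FFF, 0x700AE6344253037),
  (0x808FAAAF, 0x80055C267137057), (0x808FAABF, 0x7057C4170163061), (0x808FAAFF, 0xADFC002B31B5085),
  (0x808FABAF, 0xBE070B27B167079), (0x808FABBF, 0x5F0905285091093), (0x808FABFF, 0x81F760205107026),
  (0x808FAFAF, 0xBE060B27B167079), (0x808FAFBF, 0x8004B8294066075), (0x808FAFFF, 0xA9E600226008135),
  (0x808FB3BF, 0x74032B108105017), (0x808FB3FF, 0xACA400212144042), (0x808FBBBF, 0x4E57003641B3093),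
  (0x808FBBFF, 0x6D2600145064063), (0x808FBFBF, 0x89060F27B047058), (0x808FBFFF, 0),
  (0x808FF0FF, 0xB0B8F00D1196183), (0x808FF1FF, 0x9F9300042183165), (0x808FF3FF, 0x9005E42B2281085),
  (0x808FF7FF, 0xAE050C339045079), (0x808FFFFF, 0xBD060B26908A157), (0x80AAAAAB, 0xE20E3F847808008),
  (0x80AAAAAF, 0xBFCB00674468084), (0x80AAAABF, 0x6C3701260165063), (0x80AAAAFF, 0xF1DF907048360BB),
  (0x80AAABAB, 0x2B1904190192091), (0x80AAABAF, 0x80086F147219037), (0x80AAABBF, 0x9008CC258175066),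
  (0x80AAABFF, 0xB0FAE02CB2BA099), (0x80AAAFAF, 0x9BA500144126045), (0x80AAAFBF, 0xA005E9293288085),
  (0x80AAAFFF, 0x97B310124004033), (0x80AABFBF, 0x74B320154105035), (0x80AABFFF, 0x3A68000B3068076),
  (0x80AACCFF, 0x80067C12A178037), (0x80AACDFF, 0x60C86021714701A), (0x80AACFFF, 0x6B6600281162076),
  (0x80AADDFF, 0xA0F6C013419606A), (0x80AADFFF, 0x7B1402165153080), (0x80AAFFFF, 0xA8F500175119059),
  (0x80ABABAB, 0x22090C102122012), (0x80ABABAF, 0x69B700365227046), (0x80ABABBF, 0x300CBA104122013),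
  (0x80ABABFF, 0x88D700274265046), (0x80ABAFAF, 0xCE6300124131023), (0x80ABAFBF, 0x4016C2133260042),
  (0x80ABAFFF, 0xBCC500225106044), (0x80ABBFBF, 0x74041E208159038), (0x80ABBFFF, 0),
  (0x80ABCDFF, 0x6044C0160081062), (0x80ABCFFF, 0x5B4500144143062), (0x80ABDDFF, 0x3B1504050063082),
  (0x80ABDFFF, 0x80036E177159038), (0x80ABFFFF, 0x89051B15A106036), (0x80AFAFAF, 0x5099D0169156068),
  (0x80AFAFBF, 0x68D700318075047), (0x80AFAFFF, 0xAC0307146058035), (0x80AFBBBF, 0x70043D149207038),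
  (0x80AFBBFF, 0xB003B90C606A088), (0x80AFBFBF, 0x51067D266007036), (0x80AFBFFF, 0x3C38020960B0094),
  (0x80AFCFFF, 0x8EE9002960A3188), (0x80AFDDFF, 0x6E060A278054185), (0x80AFDFFF, 0),
  (0x80AFF5FF, 0x6087B0164030246), (0x80AFF7FF, 0x65040D128068026), (0x80AFFFFF, 0xCBE510204091163),
  (0x80BFBFBF, 0x4C3402060165062), (0x80BFBFFF, 0), (0x80BFDFFF, 0),
  (0x80BFFFFF, 0x5B2504056040053), (0x80FFFFFF, 0x5016D7265273080), (0x8888888B, 0xF25F51F00534001),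
  (0x8888888F, 0xB0BBD2B20045069), (0x888888AB, 0xF07F60ACA7870C4), (0x888888AF, 0xE40EAAB0D0B7219),
  (0x888888BB, 0xB06865670453036), (0x888888BF, 0xF18D218C0201043), (0x888888FF, 0xB89B0952016602A),
  (0x88888AAB, 0xC6090A9D9367059), (0x88888AAF, 0xCC6BA1D0A587050), (0x88888ABB, 0x955AC4900462093),
  (0x88888ABF, 0xB3770A560156045), (0x88888ACF, 0xA84A9EA0006403A), (0x88888ADF, 0x5506066C2063053),
  (0x88888AFF, 0xC66ABD700147075), (0x88888BBB, 0xC707007E0273072), (0x88888BBF, 0xE4789080E215036),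
  (0x88888BDF, 0x5567006E4083073), (0x88888BFF, 0x84A7009BD175046), (0x88888FFF, 0xF6780E8D00AA045),
  (0x8888AAAB, 0xD15A40A00616022), (0x8888AAAF, 0xC22DA5C2A600096), (0x8888AABB, 0xE4690A5B087B078),
  (0x8888AABF, 0x7546B2500346052), (0x8888AAFF, 0xA0795660070603D), (0x8888ABBB, 0xB407F190A641085),
  (0x8888ABBF, 0x7605C5604470065), (0x8888ABFF, 0xA545FB50C540098), (0x8888AFFF, 0x9145B053F004078),
  (0x8888BBBB, 0xB66520502566066), (0x8888BBBF, 0xB91400403390051), (0x8888BBFF, 0x9562003D325C026),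
  (0x8888BFFF, 0xC2B58150002B344), (0x8888FFFF, 0xC003C42A9072054), (0x888A8AAB, 0xB00B72809526058),
  (0x888A8AAF, 0xA05BABA40565018), (0x888A8ABB, 0xA009A372B346054), (0x888A8ABF, 0xB9BA5EA00539087),
  (0x888A8ACF, 0x600B1E693154034), (0x888A8ADF, 0x8A070085F046042), (0x888A8AFF, 0x6ACC1060E23B05A),
  (0x888A8BBB, 0x80036650C137037), (0x888A8BBF, 0x7016B0B1E175064), (0x888A8BCF, 0xAC056D606146067),
  (0x888A8BDF, 0x94B400580142033), (0x888A8BFF, 0xBEBB0020E03D03B), (0x888A8CFF, 0x64C60C720219069),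
  (0x888A8DDF, 0x3B0AEC905093092), (0x888A8DFF, 0x87D9A0205036027), (0x888A8FFF, 0x84092D880365003),
  (0x888AAAAB, 0xA04EB0DC874504A), (0x888AAAAF, 0xB019A6BE1560087), (0x888AAABB, 0xC08840884744002),
  (0x888AAABF, 0x73070A76E255036), (0x888AAAFF, 0x6005576B5151043), (0x888AABBB, 0xA0061F48B327049),
  (0x888AABBF, 0xAF070445A383076), (0x888AABFF, 0xB0059B3D41A3095), (0x888AAFFF, 0xA8040731D204049),
  (0x888ABBBB, 0xBB066C606566084), (0x888ABBBF, 0x9D0401417274053), (0x888ABBFF, 0x92F443210106027),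
  (0x888ABFFF, 0), (0x888ACCCF, 0xC82E6CC0404E690), (0x888ACCDF, 0x5E09697000912C0),
  (0x888ACCFF, 0x60B565640057106), (0x888ACDDF, 0x7C03BA809087195), (0x888ACDFF, 0x59A47050807518B),
  (0x888ACFFF, 0x86B8006E318406B), (0x888ADDDF, 0xBE040854E068297), (0x888ADDFF, 0x60B286550057028),
  (0x888ADFFF, 0xA6B57050234405A), (0x888AFFFF, 0x5064804B5143047), (0x888B8BBB, 0x7CD70DBD0168069),
  (0x888B8BBF, 0x5D0AED901185094), (0x888B8BDF, 0x720B0E7F0095085), (0x888B8BFF, 0x9077DB4A0183095),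
  (0x888B8DFF, 0xA0023C9E605A158), (0x888B8FFF, 0x62CC004DC09908A), (0x888BAAAB, 0x51DA00A8232A038),
  (0x888BAAAF, 0x9069B08D4485070), (0x888BAABB, 0xBE050742B247047), (0x888BAABF, 0xAD3317500146035),
  (0x888BAAFF, 0x9005C52E21A0093), (0x888BABBB, 0x8003B09BC263083), (0x888BABBF, 0x87E305750128037),
  (0x888BABFF, 0x9D0503248166055), (0x888BAFFF, 0xD003C52F42B60D2), (0x888BBBBB, 0x30057850B113013),
  (0x888BBBBF, 0x8053C44C0262083), (0x888BBBFF, 0x74030A12C138027), (0x888BBFFF, 0),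
  (0x888BCCCF, 0x71060B97F047235), (0x888BCCDF, 0xBB038D60C07B18A), (0x888BCCFF, 0x62E851610324008),
  (0x888BCDDF, 0x9C03DC90D0992A7), (0x888BCDFF, 0x7AD209620028049), (0x888BCFFF, 0x6093706D4173055),
  (0x888BDDDF, 0x5FC7097600A92CB), (0x888BDDFF, 0x4006B735A054034), (0x888BDFFF, 0x59070A47B267075),
  (0x888BFFFF, 0xCFF440402256085), (0x888F8FFF, 0), (0x888FAAAF, 0x7037B27C6375090),
  (0x888FAABF, 0x90B3605B5143063), (0x888FAAFF, 0xBFB4803000451A1), (0x888FABBF, 0x9E0603348272065),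
  (0x888FABFF, 0xBA030D406213039), (0x888FAFFF, 0x8003832C1164090), (0x888FBBBF, 0xB0E4D55B0256086),
  (0x888FBBFF, 0x7B0204328155034), (0x888FBFFF, 0), (0x888FFFFF, 0x8D036D308087065),
  (0x88AAAAAB, 0x8068B2640565075), (0x88AAAAAF, 0x6B0705576250063), (0x88AAAABB, 0x6B3700357360063),
  (0x88AAAABF, 0x6C3702358250063), (0x88AAAAFF, 0x99790452B656070), (0x88AAABAB, 0xD4FC00A8680705B),
  (0x88AAABAF, 0x7B1506540266054), (0x88AAABBB, 0x60065B373317035), (0x88AAABBF, 0x70B650388214036),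
  (0x88AAABFF, 0x8608CF5031D20B6), (0x88AAAFAF, 0x9E1707650377071), (0x88AAAFBF, 0x45D92028B00A03A),
  (0x88AAAFFF, 0x5523B0001193070), (0x88AABBBB, 0x63B760405357059), (0x88AABBBF, 0x8065A03B5442075),
  (0x88AABBFF, 0xC01BBB5C084600D), (0x88AABFBF, 0x9004BB1B1347074), (0x88AABFFF, 0x4734030B0254253),
  (0x88AACCFF, 0x8458823000C8644), (0x88AACDFF, 0x8805EF8070AB192), (0x88AACFFF, 0x50459F290077007),
  (0x88AADDFF, 0x62040D268108004), (0x88AADFFF, 0x9003B842A276042), (0x88AAFFFF, 0x97097B4056760E5),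
  (0x88ABABAB, 0x61C770504357036), (0x88ABABAF, 0x70E870605269037), (0x88ABABBB, 0xDEF502690437055),
  (0x88ABABBF, 0xBAD401680215034), (0x88ABABFF, 0x7D1708340352075), (0x88ABAFAF, 0x90D330695213044),
  (0x88ABAFBF, 0x90D320594203034), (0x88ABAFFF, 0xD0F373150284042), (0x88ABBBBB, 0x6E060536A453073),
  (0x88ABBBBF, 0x8007D837C473057), (0x88ABBBFF, 0x6D6506260263075), (0x88ABBFBF, 0x5042B0599150053),
  (0x88ABBFFF, 0), (0x88ABCDFF, 0x80B2603A7072165), (0x88ABCFFF, 0x3FCB036F02A50CA),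
  (0x88ABDDFF, 0x40D27311005611A), (0x88ABDFFF, 0x4B0606268345072), (0x88ABFFFF, 0x40B5803B8134038),
  (0x88AFAFAF, 0x50B570414067024), (0x88AFAFBF, 0x5B05078CE141076), (0x88AFAFFF, 0x66B9C060A0CC358),
  (0x88AFBBBF, 0x4045C4280245063), (0x88AFBBFF, 0x26C424000139048), (0x88AFBFBF, 0x60B3806DB134056),
  (0x88AFBFFF, 0x4077E501003A023), (0x88AFCFFF, 0xB004CF3B51A80C2), (0x88AFDDFF, 0x40C381120064026),
  (0x88AFDFFF, 0), (0x88AFFFFF, 0x78B424450008254), (0x88BBBBBB, 0x6E0503198271071),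
  (0x88BBBBBF, 0x6C170B210288076), (0x88BBBBFF, 0x78760200B444060), (0x88BBBFBF, 0x5F460B170289096),
  (0x88BBBFFF, 0x42951004D207217), (0x88BBDDFF, 0x56050D099127134), (0x88BBDFFF, 0x3C380E230256096),
  (0x88BBFFFF, 0x7796801035840D5), (0x88BFBFBF, 0x3D2502267070072), (0x88BFBFFF, 0),
  (0x88BFDFFF, 0), (0x88BFFFFF, 0x5004A20E0273272), (0x88FFFFFF, 0x50079F1A325702A),
  (0x8AAAAAAB, 0x90D8309C9957067), (0x8AAAAAAF, 0), (0x8AAAAABB, 0xD84B0492DB37070),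
  (0x8AAAAABF, 0), (0x8AAAAAFF, 0xC85A328099350B0), (0x8AAAABBB, 0x8CD65060B768077),
  (0x8AAAABBF, 0), (0x8AAAABFF, 0x7AFA8020D33C06B), (0x8AAAAFFF, 0),
  (0x8AAABBBB, 0x49640B410546066), (0x8AAABBBF, 0), (0x8AAABBFF, 0x6003180B1342123),
  (0x8AAABFFF, 0), (0x8AAACFFF, 0x8598E480047104C), (0x8AAADFFF, 0x92E5D550055502E),
  (0x8AAAFFFF, 0xC5569EA2BA5A000), (0x8AABABBB, 0x50B9CC620868056), (0x8AABABBF, 0),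
  (0x8AABABFF, 0x8C560A110221034), (0x8AABAFFF, 0), (0x8AABBBBB, 0x4C046A403555083),
  (0x8AABBBBF, 0), (0x8AABBBFF, 0xA005BC22F34C059), (0x8AABBFFF, 0),
  (0x8AABCFFF, 0x60E6403790A6149), (0x8AABDFFF, 0x6035CB3D03B5065), (0x8AABFFFF, 0x4D421070D444095),
  (0x8AAFAFFF, 0), (0x8AAFBBBF, 0x31030C387322035), (0x8AAFBBFF, 0),
  (0x8AAFBFFF, 0), (0x8AAFCFFF, 0x8DF706494070387), (0x8AAFDFFF, 0),
  (0x8AAFFFFF, 0), (0x8ABBBBBB, 0x4FD3092A058807A), (0x8ABBBBBF, 0),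
  (0x8ABBBBFF, 0x5095BD090476169), (0x8ABBBFBF, 0x45001D201227035), (0x8ABBBFFF, 0),
  (0x8ABBCFFF, 0x4CD45020A125067), (0x8ABBDFFF, 0x29B260208245077), (0x8ABBFFFF, 0x4CC480007366197),
  (0x8ABFBFBF, 0), (0x8ABFBFFF, 0), (0x8ABFCFFF, 0x6DF4B44030903A7),
  (0x8ABFDFFF, 0), (0x8ABFFFFF, 0), (0x8ACFFFFF, 0x43544F6D0354008),
  (0x8ADFDFDF, 0x2A020616B057144), (0x8ADFDFFF, 0), (0x8ADFFFFF, 0x3004E327A265080),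
  (0x8AFFFFFF, 0x33E3C700035718A), (0x8BBBBBBB, 0x13B1001B3254054), (0x8BBBBBBF, 0),
  (0x8BBBBBFF, 0x30E2BE0A028807A), (0x8BBBBFFF, 0), (0x8BBBDFFF, 0x4401E900C169057),
  (0x8BBBFFFF, 0x2B7006050144064), (0x8BBFBFFF, 0), (0x8BBFDFFF, 0),
  (0x8BBFFFFF, 0), (0x8BDFFFFF, 0x07000408B066034), (0x8BFFFFFF, 0x36A1010C0374256),
  (0x8FFFFFFF, 0), (0xAAAAAAAB, 0xC62C30C36C11005), (0xAAAAAAAF, 0x690A757B5302061),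
  (0xAAAAAABF, 0x61359A70D8A0057), (0xAAAAAAFF, 0x83C8745005E504A), (0xAAAAABBF, 0x58461067C408046),
  (0xAAAAABFF, 0x70874035C29A068), (0xAAAAAFFF, 0x9682DA20C35007B), (0xAAAABFFF, 0x4742BD1061D0086),
  (0xAAAAFFFF, 0x5D745F3403080B7), (0xAAABABBF, 0x6007B958141A045), (0xAAABABFF, 0x6387003A62B3073),
  (0xAAABAFFF, 0x70053B3B43A8064), (0xAAABBFFF, 0), (0xAAABFFFF, 0x37B4404043A2068),
  (0xAAAFAFFF, 0x6827A95E00003B3), (0xAAAFBBBF, 0x28256970C260053), (0xAAAFBBFF, 0x4063985D2230055),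
  (0xAAAFBFFF, 0x5447AD5B3000375), (0xAAAFFFFF, 0x6305664080D7335), (0xAABFBFBF, 0x4005B9239190064),
  (0xAABFBFFF, 0), (0xAABFFFFF, 0x4CC5431B0009177), (0xAAFFFFFF, 0x2B2400354086252),
  (0xABBFBFFF, 0), (0xABBFFFFF, 0), (0xABFFFFFF, 0x07000508B0A4053),
  (0xAFFFFFFF, 0x40504E293000336), (0xBFFFFFFF, 0x16020500C1A9446), (0xFFFFFFFF, 0x0D61301090B114A)]

theorem length_table : table.length = 672 := by decide +kernel

theorem isChain_table : (table.map Prod.fst).IsChain (· < ·) := by decide +kernel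

theorem table_all_convex : (table.all fun t => Nat.ble t.1 0xFFFFFFFF &&
    t.1.testBit 0 && t.1.testBit 31 &&
      (List.range 31).all (locallyConvexAt t.1)) = true := by decide +kernel

theorem table_all_least : (table.all fun t => isLeastMask t.1) = true := by
  decide +kernel

/-- The summands are the orbit sizes. Agreement with the bound from the search is what proves the
table complete. -/
theorem sum_table : ((table.map Prod.fst).map fun m => 120 / stabilizerCount m).sum = 59386 := by
  decide +kernel

theorem countP_table : 623 ≤ table.countP fun t => representsMask t.2 t.1 := by
  decide +kernel

/-! ### Completeness of the table -/

/-- The least masks of the families of closed sets of convex geometries on `Fin 5`. -/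
def leastMasks : Finset ℕ := (table.map Prod.fst).toFinset

theorem nodup_map_table : (table.map Prod.fst).Nodup :=
  (List.isChain_iff_pairwise.1 isChain_table).imp ne_of_lt

theorem card_leastMasks : leastMasks.card = 672 := by
  rw [leastMasks, List.toFinset_card_of_nodup nodup_map_table, List.length_map, length_table]

theorem mem_leastMasks {m : ℕ} : m ∈ leastMasks ↔ ∃ t ∈ table, t.1 = m := by
  rw [leastMasks, List.mem_toFinset, List.mem_map]

attribute [local irreducible] leastMasks table

theorem lt_of_mem_leastMasks {m : ℕ} (hm : m ∈ leastMasks) : m < 2 ^ 32 := by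
  obtain ⟨t, ht, rfl⟩ := mem_leastMasks.1 hm
  have h := List.all_eq_true.1 table_all_convex t ht
  simp only [Bool.and_eq_true] at h
  exact Nat.lt_succ_of_le (Nat.le_of_ble_eq_true h.1.1.1)

theorem isConvexFamily_of_mem_leastMasks {m : ℕ} (hm : m ∈ leastMasks) :
    IsConvexFamily (maskFamily m) := by
  obtain ⟨t, ht, rfl⟩ := mem_leastMasks.1 hm
  have h := List.all_eq_true.1 table_all_convex t ht
  simp only [Bool.and_eq_true] at h
  exact isConvexFamily_maskFamily.2 ⟨h.1.1.2, h.1.2, fun b hb =>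
    List.all_eq_true.1 h.2 b (List.mem_range.2 hb)⟩

theorem isLeastMask_of_mem_leastMasks {m : ℕ} (hm : m ∈ leastMasks) : isLeastMask m = true := by
  obtain ⟨t, ht, rfl⟩ := mem_leastMasks.1 hm
  exact List.all_eq_true.1 table_all_least t ht

theorem eq_of_smul_maskFamily_eq {m n : ℕ} (hm : m ∈ leastMasks) (hn : n ∈ leastMasks)
    {σ : Equiv.Perm (Fin 5)} (h : σ • maskFamily m = maskFamily n) : m = n :=
  le_antisymm
    (le_of_isLeastMask (isLeastMask_of_mem_leastMasks hm) (lt_of_mem_leastMasks hm)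
      (lt_of_mem_leastMasks hn) h)
    (le_of_isLeastMask (isLeastMask_of_mem_leastMasks hn) (lt_of_mem_leastMasks hn)
      (lt_of_mem_leastMasks hm) (inv_smul_eq_iff.2 h.symm))

theorem ncard_isConvexFamily_le :
    {C : Set (Set (Fin 5)) | IsConvexFamily C}.ncard ≤ 59386 := by
  have h1 : {C : Set (Set (Fin 5)) | IsConvexFamily C} ⊆ maskFamily ''
      {m : ℕ | m >>> 31 = 1 ∧ m.testBit 0 = true ∧ ∀ b < 31, locallyConvexAt m b = true} := by
    intro C hC
    obtain ⟨m, hm, rfl⟩ := exists_maskFamily_eq C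
    obtain ⟨h0, h31, h⟩ := isConvexFamily_maskFamily.1 hC
    refine ⟨m, ⟨?_, h0, h⟩, rfl⟩
    rw [Nat.testBit_eq_decide_div_mod_eq, decide_eq_true_eq] at h31
    rw [Nat.shiftRight_eq_div_pow]
    omega
  have h2 := (Set.encard_le_encard h1).trans
    ((Set.encard_image_le _ _).trans (encard_le_countFamilies 31 1))
  rw [countFamilies_eq, ← (Set.toFinite _).cast_ncard_eq] at h2
  exact_mod_cast h2

theorem IsConvexFamily.smul {X : Type*} {C : Set (Set X)} (h : IsConvexFamily C)
    (σ : Equiv.Perm X) : IsConvexFamily (σ • C) := by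
  convert h.preimage σ using 1
  ext A
  rw [Set.mem_smul_set_iff_inv_smul_mem, Set.mem_ofPred_eq]
  have : σ⁻¹ • A = σ ⁻¹' A := by
    ext x
    rw [Set.mem_inv_smul_set_iff]
    rfl
  rw [this]

/-- The orbits of the table entries are disjoint sets of convex families with 59386 members in
total. There are no more convex families than that, so every one lies in some orbit. -/
theorem exists_smul_maskFamily_eq {C : Set (Set (Fin 5))} (hC : IsConvexFamily C) :
    ∃ m ∈ leastMasks, ∃ σ : Equiv.Perm (Fin 5), σ • maskFamily m = C := by
  classical
  let orb : ℕ → Finset (Set (Set (Fin 5))) := fun m =>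
    (Set.toFinite (MulAction.orbit (Equiv.Perm (Fin 5)) (maskFamily m))).toFinset
  let conv : Finset (Set (Set (Fin 5))) := (Set.toFinite {C | IsConvexFamily C}).toFinset
  have hsub : leastMasks.biUnion orb ⊆ conv := by
    intro D hD
    obtain ⟨m, hm, hDm⟩ := Finset.mem_biUnion.1 hD
    obtain ⟨σ, rfl⟩ := (Set.Finite.mem_toFinset _).1 hDm
    exact (Set.Finite.mem_toFinset _).2 ((isConvexFamily_of_mem_leastMasks hm).smul σ)
  have hcard : (leastMasks.biUnion orb).card = 59386 := by
    rw [Finset.card_biUnion]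
    · have : ∀ m ∈ leastMasks, (orb m).card = 120 / stabilizerCount m := fun m hm => by
        have h := ncard_orbit_mul_stabilizerCount (lt_of_mem_leastMasks hm)
        rw [Set.ncard_eq_toFinset_card _ (Set.toFinite _)] at h
        refine (Nat.div_eq_of_eq_mul_left (Nat.pos_of_ne_zero ?_) h.symm).symm
        intro h0
        rw [h0, mul_zero] at h
        exact absurd h (by decide)
      rw [Finset.sum_congr rfl this, leastMasks, List.sum_toFinset _ nodup_map_table, sum_table]
    · intro m hm n hn hmn
      refine Finset.disjoint_left.2 fun D hD hD' => hmn ?_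
      obtain ⟨σ, rfl⟩ := (Set.Finite.mem_toFinset _).1 hD
      obtain ⟨τ, hτ⟩ := (Set.Finite.mem_toFinset _).1 hD'
      exact (eq_of_smul_maskFamily_eq hn hm (σ := σ⁻¹ * τ) (by
        rw [mul_smul, inv_smul_eq_iff]; exact hτ)).symm
  have heq := Finset.eq_of_subset_of_card_le hsub (by
    rw [hcard, ← Set.ncard_eq_toFinset_card]; exact ncard_isConvexFamily_le)
  have hmem : C ∈ leastMasks.biUnion orb := heq ▸ (Set.Finite.mem_toFinset _).2 hC
  obtain ⟨m, hm, hCm⟩ := Finset.mem_biUnion.1 hmem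
  obtain ⟨σ, hσ⟩ := (Set.Finite.mem_toFinset _).1 hCm
  exact ⟨m, hm, σ, hσ⟩

/-! ### Counting isomorphism classes and representable classes -/

namespace ConvexGeometry

theorem exists_closedSets_eq_maskFamily (m : leastMasks) :
    ∃ G : ConvexGeometry (Fin 5), G.closedSets = maskFamily m :=
  (isConvexFamily_of_mem_leastMasks m.2).exists_closedSets_eq

/-- The convex geometry on `Fin 5` with a given least mask. -/
noncomputable def ofLeastMask (m : leastMasks) : ConvexGeometry (Fin 5) :=
  (exists_closedSets_eq_maskFamily m).choose

theorem closedSets_ofLeastMask (m : leastMasks) : (ofLeastMask m).closedSets = maskFamily m :=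
  (exists_closedSets_eq_maskFamily m).choose_spec

theorem ofLeastMask_isomorphic {m n : leastMasks} (h : Isomorphic (ofLeastMask m) (ofLeastMask n)) :
    m = n := by
  obtain ⟨σ, hσ⟩ := isomorphic_iff_exists_smul.1 h
  rw [closedSets_ofLeastMask, closedSets_ofLeastMask] at hσ
  exact Subtype.ext (eq_of_smul_maskFamily_eq m.2 n.2 hσ)

theorem exists_isomorphic_ofLeastMask (G : ConvexGeometry (Fin 5)) :
    ∃ m, Isomorphic (ofLeastMask m) G := by
  obtain ⟨m, hm, σ, hσ⟩ := exists_smul_maskFamily_eq G.isConvexFamily_closedSets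
  exact ⟨⟨m, hm⟩, isomorphic_iff_exists_smul.2 ⟨σ, by rw [closedSets_ofLeastMask, hσ]⟩⟩

theorem le_ncard_representableByCircles :
    623 ≤ {m : leastMasks | (ofLeastMask m).RepresentableByCircles}.ncard := by
  classical
  set good := (table.filter fun t => representsMask t.2 t.1).map Prod.fst with hgood
  have hnodup : good.Nodup := nodup_map_table.sublist (List.filter_sublist.map _)
  have h1 : 623 ≤ good.toFinset.card := by
    rw [List.toFinset_card_of_nodup hnodup, hgood, List.length_map, ← List.countP_eq_length_filter]
    exact countP_table
  refine h1.trans ?_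
  rw [← Set.ncard_image_of_injective _ Subtype.val_injective, ← Set.ncard_coe_finset]
  refine Set.ncard_le_ncard (fun m hm => ?_) (Set.toFinite _)
  obtain ⟨t, ht, rfl⟩ := List.mem_map.1 (List.mem_toFinset.1 (Finset.mem_coe.1 hm))
  obtain ⟨ht1, ht2⟩ := List.mem_filter.1 ht
  exact ⟨⟨t.1, mem_leastMasks.2 ⟨t, ht1, rfl⟩⟩,
    representableByCircles_of_representsMask (closedSets_ofLeastMask _) ht2, rfl⟩

end ConvexGeometry

theorem mainTheorem7 {X : Type*} (hX : Nat.card X = 5) :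
    Nat.card (ConvexGeometry.IsoClass X) = 672 ∧
      623 ≤ {q : ConvexGeometry.IsoClass X |
        ∀ G : ConvexGeometry X, G.isoClass = q → G.RepresentableByCircles}.ncard := by
  have : Finite X := Nat.finite_of_card_ne_zero (by rw [hX]; decide)
  let e : X ≃ Fin 5 := Finite.equivFinOfCardEq hX
  -- Transport each table geometry from `Fin 5` to `X`; the resulting classes correspond bijectively
  -- to the table.
  choose R hR using fun m => ConvexGeometry.exists_isomorphic e.symm (ConvexGeometry.ofLeastMask m)
  let F : leastMasks → ConvexGeometry.IsoClass X := fun m => (R m).isoClass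
  have hF : Function.Bijective F := by
    refine ⟨fun m n h => ConvexGeometry.ofLeastMask_isomorphic ?_, fun q => ?_⟩
    · exact ((hR m).trans (Quotient.exact h)).trans (hR n).symm
    · induction q using Quotient.inductionOn with
      | h G =>
        obtain ⟨H, hH⟩ := ConvexGeometry.exists_isomorphic e G
        obtain ⟨m, hm⟩ := ConvexGeometry.exists_isomorphic_ofLeastMask H
        exact ⟨m, Quotient.sound (((hR m).symm.trans hm).trans hH.symm)⟩
  have hcard : Nat.card (ConvexGeometry.IsoClass X) = 672 := by
    rw [← Nat.card_eq_of_bijective F hF, Nat.card_eq_fintype_card, Fintype.card_coe,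
      card_leastMasks]
  have : Finite (ConvexGeometry.IsoClass X) := Nat.finite_of_card_ne_zero (by rw [hcard]; decide)
  refine ⟨hcard, ConvexGeometry.le_ncard_representableByCircles.trans ?_⟩
  rw [← Set.ncard_image_of_injective _ hF.injective]
  refine Set.ncard_le_ncard ?_ (Set.toFinite _)
  -- Representability is invariant under isomorphism, so the circles of the table geometry serve
  -- every member of its class.
  rintro _ ⟨m, hm, rfl⟩ G hG
  exact hm.of_isomorphic ((hR m).trans (Quotient.exact hG.symm))
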